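/- A dessin of degree $n\ge 1$ is a triple $(x,y,z)$ of permutations of an $n$-element set (the edges) with $xyz=1$ that generates a transitive group, its monodromy group $G$; isomorphism is simultaneous conjugation of the triples by a bijection of the edge sets (so mirror images count separately unless isomorphic). The cycles of $x$, $y$, $z$ are the black vertices, white vertices and faces, and their lengths are the degrees. A $(3,2,7)$-map is a dessin for which $x,y,z$ have orders $3,2,7$. It is imprimitive if $G$ is an imprimitive permutation group. (a) Up to isomorphism there are exactly twelve $(3,2,7)$-maps, of any degree, with exactly two faces of degree $7$: three of degree $14$ with $G\cong{\rm PSL}_2(13)$; six imprimitive maps of degree $14$, of which four have $|G|=1344$ and two have $G\cong{\rm PSL}_3(2)$; and three of degree $15$ with $G\cong{\rm A}_{15}$. (b) Up to isomorphism there are exactly four $(3,2,7)$-maps, of any degree, with exactly one face of degree $7$: two trees of degree $7$ with $G\cong{\rm PSL}_3(2)$, one map of degree $8$ with $G\cong{\rm PSL}_2(7)$, and one map of degree $9$ with $G\cong{\rm PSL}_2(8)$. (c) Let $16\le n\le 20$. No group $G$ that has a faithful quotient of degree $n$, i.e. a subgroup of index $n$ with trivial core, is a Hurwitz group, where a Hurwitz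 group is a non-trivial finite quotient of the triangle group $\Delta(2,3,7)=\langle X,Y,Z\mid X^2=Y^3=Z^7=XYZ=1\rangle$. In particular, the alternating group ${\rm A}_n$ is not a Hurwitz group. -/

import Mathlib

/-- A dessin d'enfant with edges labelled by `Fin degree`, given by its monodromy: permutations
`x`, `y`, `z` of the (non-empty) set of edges, generating a transitive group, with `xyz = 1`.
Permutations in the product `xyz` are composed from left to right; since Lean composes from right
to left, this reads `z * y * x = 1`. The cycles of `x`, `y` and `z` (including fixed points) are
the black vertices, the white vertices and the faces, and the cycle lengths are their degrees. -/
structure Dessin where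
  degree : ℕ
  degree_pos : 0 < degree
  x : Equiv.Perm (Fin degree)
  y : Equiv.Perm (Fin degree)
  z : Equiv.Perm (Fin degree)
  xyz_eq_one : z * y * x = 1
  transitive : MulAction.IsPretransitive (Subgroup.closure {x, y, z}) (Fin degree)

namespace Dessin

/-- The monodromy group, a transitive permutation group on the edges. -/
def monodromyGroup (D : Dessin) : Subgroup (Equiv.Perm (Fin D.degree)) :=
  Subgroup.closure {D.x, D.y, D.z}

/-- Two dessins are isomorphic if some bijection between the edges carries the monodromy
permutations of the one to those of the other (orientation-preserving isomorphism; mirror images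
need not be isomorphic). -/
def IsIso (D D' : Dessin) : Prop :=
  ∃ e : Fin D.degree ≃ Fin D'.degree,
    (∀ i, e (D.x i) = D'.x (e i)) ∧ (∀ i, e (D.y i) = D'.y (e i)) ∧ (∀ i, e (D.z i) = D'.z (e i))

theorem isIso_equivalence : Equivalence IsIso where
  refl D := ⟨Equiv.refl _, fun _ => rfl, fun _ => rfl, fun _ => rfl⟩
  symm := by
    rintro D D' ⟨e, hx, hy, hz⟩
    refine ⟨e.symm, fun i => ?_, fun i => ?_, fun i => ?_⟩
    · rw [Equiv.symm_apply_eq, hx, Equiv.apply_symm_apply]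
    · rw [Equiv.symm_apply_eq, hy, Equiv.apply_symm_apply]
    · rw [Equiv.symm_apply_eq, hz, Equiv.apply_symm_apply]
  trans := by
    rintro D D' D'' ⟨e, hx, hy, hz⟩ ⟨f, kx, ky, kz⟩
    refine ⟨e.trans f, fun i => ?_, fun i => ?_, fun i => ?_⟩
    · simp [hx, kx]
    · simp [hy, ky]
    · simp [hz, kz]

instance isoSetoid : Setoid Dessin := ⟨IsIso, isIso_equivalence⟩

/-- Isomorphism classes of dessins (of arbitrary degree). -/
def IsoClass : Type := Quotient isoSetoid

/-- The number, possibly infinite, of isomorphism classes of dessins with property `P`. -/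
noncomputable def numberUpToIso (P : Dessin → Prop) : ℕ∞ :=
  Set.encard {c : IsoClass | ∃ D : Dessin, P D ∧ Quotient.mk isoSetoid D = c}

/-- The type of `D` is the triple of orders of `x`, `y` and `z`. A dessin of type `(p, 2, r)`, with
its white vertices left implicit, is a `(p, 2, r)`-map. -/
def HasType (D : Dessin) (p q r : ℕ) : Prop :=
  orderOf D.x = p ∧ orderOf D.y = q ∧ orderOf D.z = r

/-- The number of faces of degree `d`, that is, of cycles of `z` of length `d`. -/
def faceCount (D : Dessin) (d : ℕ) : ℕ := D.z.partition.parts.count d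

/-- `D` is imprimitive: its (transitive) monodromy group preserves a nontrivial block system. -/
def IsImprimitive (D : Dessin) : Prop :=
  ¬ MulAction.IsPreprimitive D.monodromyGroup (Fin D.degree)

/-- The black vertices: the cycles of `x`, including fixed points. -/
abbrev BlackVertex (D : Dessin) : Type := Quotient (Equiv.Perm.SameCycle.setoid D.x)

/-- The white vertices: the cycles of `y`, including fixed points. -/
abbrev WhiteVertex (D : Dessin) : Type := Quotient (Equiv.Perm.SameCycle.setoid D.y)

/-- The black vertex of an edge. -/
def blackEnd (D : Dessin) (i : Fin D.degree) : D.BlackVertex := Quotient.mk _ i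

/-- The white vertex of an edge. -/
def whiteEnd (D : Dessin) (i : Fin D.degree) : D.WhiteVertex := Quotient.mk _ i

/-- The simple graph underlying the bicoloured graph of `D`: a black and a white vertex are
adjacent if at least one edge joins them. -/
def graph (D : Dessin) : SimpleGraph (D.BlackVertex ⊕ D.WhiteVertex) :=
  SimpleGraph.fromRel fun u v => ∃ i, u = Sum.inl (D.blackEnd i) ∧ v = Sum.inr (D.whiteEnd i)

/-- `D` is a tree: its bicoloured graph has no multiple edges and is a tree. -/
def IsTree (D : Dessin) : Prop :=
  Function.Injective (fun i => (D.blackEnd i, D.whiteEnd i)) ∧ D.graph.IsTree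

/-- `D` is a `(3,2,7)`-map with exactly `k` faces of degree `7`. -/
def IsMap327 (k : ℕ) (D : Dessin) : Prop :=
  D.HasType 3 2 7 ∧ D.faceCount 7 = k

/-- The monodromy group of `D` is isomorphic to `PSL_n(K)`. -/
def HasMonodromyPSL (D : Dessin) (n : ℕ) (K : Type) [CommRing K] : Prop :=
  Nonempty (D.monodromyGroup ≃* Matrix.ProjectiveSpecialLinearGroup (Fin n) K)

end Dessin

/-- The triangle group `Δ(p,q,r) = ⟨X, Y, Z | X^p = Y^q = Z^r = XYZ = 1⟩`. -/
abbrev TriangleGroup (p q r : ℕ) : Type :=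
  PresentedGroup ({FreeGroup.of 0 ^ p, FreeGroup.of 1 ^ q, FreeGroup.of 2 ^ r,
    FreeGroup.of 0 * FreeGroup.of 1 * FreeGroup.of 2} : Set (FreeGroup (Fin 3)))

/-- A Hurwitz group: a non-trivial finite quotient of `Δ(2,3,7)`. -/
def IsHurwitzGroup (G : Type*) [Group G] : Prop :=
  Finite G ∧ Nontrivial G ∧ ∃ f : TriangleGroup 2 3 7 →* G, Function.Surjective f

/-- `G` has a faithful quotient of degree `n`: it has a subgroup of index `n` with trivial core,
that is, it acts faithfully on the `n` cosets of some subgroup of index `n`. -/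
def HasFaithfulQuotient (G : Type*) [Group G] (n : ℕ) : Prop :=
  ∃ H : Subgroup G, H.index = n ∧ H.normalCore = ⊥

/-! In a (3,2,7)-map every cycle of `z` has length 1 or 7, and an edge and its image under `y` are
never both fixed by `z` (`HasType.z_y_ne`). Hence the action of `y` on the N = 7k edges around the k
faces of degree 7 determines the map: label these edges along the faces and record `y` as a table,
with the extra value N for an image fixed by `z`. Maps with equal tables are isomorphic
(`IsRoot.isIso`), and the relation (zy)³ = 1 restricts the tables severely (`IsRoot.isTable`).

For k = 2, transitivity gives an edge `u` such that `u` and `y u` lie on different faces of degree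
7, so the labels can be chosen with table value 7 at 0 (`exists_isRoot_fourteen`). A sound
backtracking search (`IsTable.mem_of_allTablesIn`), evaluated in the kernel, places every table in a
list of 28 for k = 1 and 58 for k = 2. Each listed table comes from one of 4, respectively 12,
explicit maps, and fixed points of suitable words tell these apart.

The groups are identified through a model of the edge set. PSL₂(q) acts on a projective line;
PSL₃(2) acts on the points of the Fano plane or on its 14 oriented lines; the groups of order 1344
are the full automorphism group of the 14 imaginary octonion units under product and opposite; A₁₅
is recognised by Jordan's theorem from primitivity and a 3-cycle.

A Hurwitz group with a faithful quotient of degree n yields a (3,2,7)-map of degree n. If n ≤ 20,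
then k ≤ 2 because 7k ≤ n, and the classification gives n ≤ 15. -/

/-! ### Words, orbits and primitivity of permutation groups -/

/-- The value of a word in two letters: `0` stands for `x`, any other letter for `y`. -/
def wordValue {G : Type*} [Monoid G] (x y : G) : List ℕ → G
  | [] => 1
  | 0 :: w => x * wordValue x y w
  | (_ + 1) :: w => y * wordValue x y w

theorem wordValue_mem {G : Type*} [Group G] {H : Subgroup G} {x y : G} (hx : x ∈ H) (hy : y ∈ H) :
    ∀ w, wordValue x y w ∈ H
  | [] => H.one_mem
  | 0 :: w => H.mul_mem hx (wordValue_mem hx hy w)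
  | (_ + 1) :: w => H.mul_mem hy (wordValue_mem hx hy w)

/-- One step of the enumeration of an orbit: adjoin the images under `x` and `y`. -/
def orbitStep {α : Type*} [DecidableEq α] (x y : α → α) (F : Finset α) : Finset α :=
  F ∪ (F.image x ∪ F.image y)

/-- Turns transitivity into a finite enumeration that can be decided by evaluation. -/
theorem exists_of_mem_orbitStep_iterate {α : Type*} [DecidableEq α] {H : Subgroup (Equiv.Perm α)}
    {x y : Equiv.Perm α} (hx : x ∈ H) (hy : y ∈ H) (a : α) (k : ℕ) :
    ∀ b ∈ (orbitStep x y)^[k] {a}, ∃ g ∈ H, g a = b := by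
  induction k with
  | zero =>
    intro b hb
    exact ⟨1, H.one_mem, (Finset.mem_singleton.1 hb).symm⟩
  | succ k ih =>
    intro b hb
    rw [Function.iterate_succ_apply', orbitStep] at hb
    simp only [Finset.mem_union, Finset.mem_image] at hb
    rcases hb with hb | ⟨c, hc, rfl⟩ | ⟨c, hc, rfl⟩
    · exact ih b hb
    · obtain ⟨g, hg, rfl⟩ := ih c hc
      exact ⟨x * g, H.mul_mem hx hg, rfl⟩
    · obtain ⟨g, hg, rfl⟩ := ih c hc
      exact ⟨y * g, H.mul_mem hy hg, rfl⟩

theorem isPretransitive_of_forall_exists {α : Type*} {H : Subgroup (Equiv.Perm α)} (a : α)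
    (h : ∀ b, ∃ g ∈ H, g a = b) : MulAction.IsPretransitive H α where
  exists_smul_eq b c := by
    obtain ⟨g, hg, rfl⟩ := h b
    obtain ⟨k, hk, rfl⟩ := h c
    exact ⟨⟨k * g⁻¹, H.mul_mem hk (H.inv_mem hg)⟩, by simp [Subgroup.smul_def]⟩

/-- Transitivity, together with transitivity of the stabiliser of `a` on the other points, is
2-transitivity. -/
theorem isPreprimitive_of_two_transitive {α : Type*} {H : Subgroup (Equiv.Perm α)} (a b : α)
    (h : ∀ c, ∃ g ∈ H, g a = c) (h2 : ∀ c, c ≠ a → ∃ g ∈ H, g a = a ∧ g b = c) :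
    MulAction.IsPreprimitive H α := by
  apply MulAction.isPreprimitive_of_is_two_pretransitive
  rw [MulAction.is_two_pretransitive_iff]
  have key : ∀ {c d : α}, c ≠ d → ∃ g ∈ H, g a = c ∧ g b = d := by
    intro c d hcd
    obtain ⟨g, hg, rfl⟩ := h c
    obtain ⟨k, hk, hka, hkb⟩ := h2 (g⁻¹ d) (by
      rintro h'
      exact hcd (by rw [← h']; simp))
    exact ⟨g * k, H.mul_mem hg hk, by simp [hka], by simp [hkb]⟩
  intro c d c' d' hcd hcd'
  obtain ⟨g, hg, rfl, rfl⟩ := key hcd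
  obtain ⟨k, hk, rfl, rfl⟩ := key hcd'
  exact ⟨⟨k * g⁻¹, H.mul_mem hk (H.inv_mem hg)⟩, by simp [Subgroup.smul_def],
    by simp [Subgroup.smul_def]⟩

/-- The fibre of `f` through `a` is a block; it contains `b`, so it is not a point, and it misses
`c`, so it is not everything. -/
theorem not_isPreprimitive_of_invariant {α β : Type*} {H : Subgroup (Equiv.Perm α)} (f : α → β)
    (hf : ∀ g ∈ H, ∀ i j, f i = f j → f (g i) = f (g j)) {a b c : α} (hab : a ≠ b)
    (hfab : f a = f b) (hac : f a ≠ f c) : ¬ MulAction.IsPreprimitive H α := by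
  intro hp
  have hB : MulAction.IsBlock H {i | f i = f a} := by
    rw [MulAction.isBlock_iff_smul_eq_of_nonempty]
    rintro g ⟨i, ⟨j, hj, rfl⟩, hi⟩
    have hg : ∀ i j, f i = f j ↔ f (g • i) = f (g • j) := fun i j =>
      ⟨hf g g.2 i j, fun h => by
        have := hf _ (g⁻¹).2 _ _ h
        simpa [Subgroup.smul_def] using this⟩
    have hj' : f (g • j) = f a := hi
    ext k
    rw [Set.mem_smul_set_iff_inv_smul_mem]
    change f (g⁻¹ • k) = f a ↔ f k = f a
    rw [← show f j = f a from hj, hg, smul_inv_smul, hj', show f j = f a from hj]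
  rcases hp.isTrivialBlock_of_isBlock hB with h | h
  · exact hab (h rfl hfab.symm)
  · have : c ∈ {i | f i = f a} := by rw [h]; trivial
    exact hac this.symm

/-- As 7 is prime, all nontrivial cycles have length 7, and they fill the support. -/
theorem Equiv.Perm.seven_mul_count_partition {α : Type*} [Fintype α] [DecidableEq α]
    {z : Equiv.Perm α} (hz : orderOf z = 7) :
    7 * z.partition.parts.count 7 = z.support.card := by
  have h7 : ∀ m ∈ z.cycleType, m = 7 := by
    intro m hm
    have h1 := Equiv.Perm.dvd_of_mem_cycleType hm
    have h2 := Equiv.Perm.two_le_of_mem_cycleType hm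
    rw [hz, Nat.dvd_prime (by norm_num)] at h1
    omega
  have h8 := Multiset.eq_replicate_card.2 h7
  rw [Equiv.Perm.parts_partition, Multiset.count_add, ← Equiv.Perm.sum_cycleType, h8]
  simp [Multiset.count_replicate, mul_comm]

/-! ### Invariance under isomorphism and counting of classes -/

namespace Dessin

theorem IsIso.symm {D D' : Dessin} (h : IsIso D D') : IsIso D' D := isIso_equivalence.symm h

/-- A property of dessins that is invariant under isomorphism. -/
def Invariant (P : Dessin → Prop) : Prop := ∀ D D', IsIso D D' → P D → P D'

theorem Invariant.iff {P : Dessin → Prop} (h : Invariant P) {D D' : Dessin} (e : IsIso D D') :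
    P D ↔ P D' := ⟨h _ _ e, h _ _ e.symm⟩

theorem Invariant.and {P Q : Dessin → Prop} (hP : Invariant P) (hQ : Invariant Q) :
    Invariant fun D => P D ∧ Q D := fun D D' e h => ⟨hP D D' e h.1, hQ D D' e h.2⟩

theorem Invariant.or {P Q : Dessin → Prop} (hP : Invariant P) (hQ : Invariant Q) :
    Invariant fun D => P D ∨ Q D := fun D D' e h => h.imp (hP D D' e) (hQ D D' e)

theorem invariant_degree (n : ℕ) : Invariant fun D => D.degree = n := by
  rintro D D' ⟨e, -⟩ h
  have := Fintype.card_congr e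
  simp only [Fintype.card_fin] at this
  omega

theorem monodromyGroup_map {D D' : Dessin} (e : Fin D.degree ≃ Fin D'.degree)
    (hx : ∀ i, e (D.x i) = D'.x (e i)) (hy : ∀ i, e (D.y i) = D'.y (e i))
    (hz : ∀ i, e (D.z i) = D'.z (e i)) :
    D.monodromyGroup.map (e.permCongrHom : _ →* Equiv.Perm (Fin D'.degree)) =
      D'.monodromyGroup := by
  have key : ∀ {a : Equiv.Perm (Fin D.degree)} {b : Equiv.Perm (Fin D'.degree)},
      (∀ i, e (a i) = b (e i)) → e.permCongrHom a = b := by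
    intro a b h
    ext i
    change (e (a (e.symm i)) : ℕ) = _
    rw [h, Equiv.apply_symm_apply]
  rw [monodromyGroup, MonoidHom.map_closure, monodromyGroup]
  congr 1
  simp only [MonoidHom.coe_coe, Set.image_insert_eq, Set.image_singleton, key hx, key hy, key hz]

theorem IsIso.nonempty_monodromyGroup_equiv {D D' : Dessin} (h : IsIso D D') :
    Nonempty (D.monodromyGroup ≃* D'.monodromyGroup) := by
  obtain ⟨e, hx, hy, hz⟩ := h
  exact ⟨(e.permCongrHom.subgroupMap D.monodromyGroup).trans
    (MulEquiv.subgroupCongr (monodromyGroup_map e hx hy hz))⟩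

theorem invariant_monodromyGroup_equiv (G : Type*) [Group G] :
    Invariant fun D => Nonempty (D.monodromyGroup ≃* G) := by
  rintro D D' e ⟨f⟩
  obtain ⟨g⟩ := e.nonempty_monodromyGroup_equiv
  exact ⟨g.symm.trans f⟩

theorem invariant_hasMonodromyPSL (n : ℕ) (K : Type) [CommRing K] :
    Invariant fun D => D.HasMonodromyPSL n K := invariant_monodromyGroup_equiv _

theorem invariant_card (n : ℕ) : Invariant fun D => Nat.card D.monodromyGroup = n := by
  intro D D' e h
  obtain ⟨g⟩ := e.nonempty_monodromyGroup_equiv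
  exact (Nat.card_congr g.toEquiv).symm.trans h

theorem invariant_isImprimitive : Invariant IsImprimitive := by
  rintro D D' ⟨e, hx, hy, hz⟩ h hp
  refine h ?_
  have hm := monodromyGroup_map e hx hy hz
  let φ : D.monodromyGroup ≃* D'.monodromyGroup :=
    (e.permCongrHom.subgroupMap D.monodromyGroup).trans (MulEquiv.subgroupCongr hm)
  let f : Fin D.degree →ₑ[φ] Fin D'.degree :=
    { toFun := e
      map_smul' := fun g i => by
        change e (g.1 i) = e (g.1 (e.symm (e i)))
        rw [Equiv.symm_apply_apply] }
  exact (MulAction.isPreprimitive_congr (φ := φ) φ.surjective (f := f) e.bijective).2 hp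

theorem invariant_isTree : Invariant IsTree := by
  rintro D D' ⟨e, hx, hy, hz⟩ ⟨hi, ht⟩
  have key : ∀ {a : Equiv.Perm (Fin D.degree)} {b : Equiv.Perm (Fin D'.degree)},
      (∀ i, e (a i) = b (e i)) → ∀ i j, a.SameCycle i j ↔ b.SameCycle (e i) (e j) := by
    intro a b h i j
    have hb : b = e.permCongr a := by
      ext i
      rw [Equiv.permCongr_apply, h, Equiv.apply_symm_apply]
    have hz : ∀ (k : ℤ) i, e ((a ^ k) i) = (b ^ k) (e i) := by
      intro k i
      rw [hb, ← show e.permCongr (a ^ k) = (e.permCongr a) ^ k from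
        map_zpow e.permCongrHom a k, Equiv.permCongr_apply, Equiv.symm_apply_apply]
    constructor
    · rintro ⟨k, rfl⟩
      exact ⟨k, (hz k i).symm⟩
    · rintro ⟨k, hk⟩
      exact ⟨k, e.injective ((hz k i).trans hk)⟩
  let eb : D.BlackVertex ≃ D'.BlackVertex := Quotient.congr e (key hx)
  let ew : D.WhiteVertex ≃ D'.WhiteVertex := Quotient.congr e (key hy)
  have hb : ∀ i, eb (D.blackEnd i) = D'.blackEnd (e i) := fun i => rfl
  have hw : ∀ i, ew (D.whiteEnd i) = D'.whiteEnd (e i) := fun i => rfl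
  constructor
  · intro i j hij
    obtain ⟨i, rfl⟩ := e.surjective i
    obtain ⟨j, rfl⟩ := e.surjective j
    simp only [← hb, ← hw, Prod.mk.injEq, EmbeddingLike.apply_eq_iff_eq] at hij
    rw [hi (Prod.ext hij.1 hij.2)]
  · let f : D.graph ≃g D'.graph :=
      { toEquiv := eb.sumCongr ew
        map_rel_iff' := by
          have hrel : ∀ u v, (∃ i, eb.sumCongr ew u = Sum.inl (D'.blackEnd i) ∧
              eb.sumCongr ew v = Sum.inr (D'.whiteEnd i)) ↔
              ∃ i, u = Sum.inl (D.blackEnd i) ∧ v = Sum.inr (D.whiteEnd i) := by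
            intro u v
            rw [← e.exists_congr_right]
            refine exists_congr fun i => ?_
            rw [← hb, ← hw]
            rcases u with u | u <;> rcases v with v | v <;> simp
          intro u v
          simp only [graph, SimpleGraph.fromRel_adj, hrel, ne_eq, EmbeddingLike.apply_eq_iff_eq] }
    exact f.isTree_iff.1 ht

/-- Once `R` represents the classes with property `P` without repetition, counting a further
invariant property `Q` only requires deciding it on the representatives. -/
theorem numberUpToIso_eq_card {ι : Type*} (R : ι → Dessin)
    (hR : ∀ i j, IsIso (R i) (R j) → i = j) {P Q : Dessin → Prop} (hP : ∀ i, P (R i))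
    (hcl : ∀ D, P D → ∃ i, IsIso D (R i)) (hQ : Invariant Q) (S : Finset ι)
    (hS : ∀ i, Q (R i) ↔ i ∈ S) : numberUpToIso (fun D => P D ∧ Q D) = S.card := by
  have hset : {c : IsoClass | ∃ D : Dessin, (P D ∧ Q D) ∧ Quotient.mk isoSetoid D = c} =
      (fun i => (Quotient.mk isoSetoid (R i) : IsoClass)) '' (S : Set ι) := by
    ext c
    constructor
    · rintro ⟨D, ⟨h1, h2⟩, rfl⟩
      obtain ⟨i, hi⟩ := hcl D h1
      exact ⟨i, (hS i).1 (hQ _ _ hi h2), Quotient.sound hi.symm⟩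
    · rintro ⟨i, hi, rfl⟩
      exact ⟨R i, ⟨hP i, (hS i).2 hi⟩, rfl⟩
  have hinj : Function.Injective (fun i => (Quotient.mk isoSetoid (R i) : IsoClass)) :=
    fun i j hij => hR i j (Quotient.exact hij)
  rw [numberUpToIso, hset]
  exact (hinj.encard_image _).trans (Set.encard_coe_eq_coe_finsetCard S)

end Dessin

/-! ### Tables of the involution and the search for them -/

/-- The successor of the label `l` in its block of seven labels. -/
def nextLabel (l : ℕ) : ℕ := if l < 7 then (l + 1) % 7 else 7 + (l - 6) % 7

/-- The predecessor of the label `l` in its block of seven labels. -/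
def prevLabel (l : ℕ) : ℕ := if l < 7 then (l + 6) % 7 else 7 + (l - 1) % 7

/-- The constraints on the table of an involution `y` on `N` labels in blocks of seven, on which a
permutation `z` acts by `nextLabel`, that follow from `(zy)³ = 1`. A label is sent to `N` if its
image under `y` is a fixed point of `z`. -/
structure IsTable (N : ℕ) (t : ℕ → ℕ) : Prop where
  le : ∀ l < N, t l ≤ N
  involutive : ∀ l < N, t l < N → t (t l) = l
  next_eq_prev : ∀ l < N, t l = N → t (nextLabel l) = prevLabel l
  triangle : ∀ l < N, t l < N → t (nextLabel (t l)) < N →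
    t (nextLabel (t (nextLabel (t l)))) = prevLabel l

/-- The values of a table that are forced, by triangles, by a list of given values. -/
def forcedByTriangles (N : ℕ) (P : List (ℕ × ℕ)) : List (ℕ × ℕ) :=
  P.flatMap fun ab =>
    if ab.2 = N then [] else
    match P.lookup (nextLabel ab.2) with
    | none => []
    | some d =>
      if d = N then [] else
      match P.lookup (nextLabel d) with
      | none => [(nextLabel d, prevLabel ab.1)]
      -- A known value that disagrees is emitted too, so that `propagate` meets the conflict.
      | some e => if e = prevLabel ab.1 then [] else [(nextLabel d, prevLabel ab.1)]

/-- Adjoin the pending values `q`, and what they force, to the list `P` of values of a table; the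
outcome is `none` if a contradiction is found. -/
def propagate (N : ℕ) : ℕ → List (ℕ × ℕ) → List (ℕ × ℕ) → Option (List (ℕ × ℕ))
  -- Stopping early is sound: it only forgoes further consequences.
  | 0, _, P => some P
  | k + 1, [], P =>
    match forcedByTriangles N P with
    | [] => some P
    | ab :: q => propagate N k (ab :: q) P
  | k + 1, ab :: q, P =>
    match P.lookup ab.1 with
    | some b => if ab.2 = b then propagate N k q P else none
    | none =>
      propagate N k
        -- For a proper label the involution gives the reverse pair. If `y a` is fixed by `z`, then
        -- (zy)³ = 1 reduces to y(z a) = z⁻¹ a.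
        ((if ab.2 = N then (nextLabel ab.1, prevLabel ab.1) else (ab.2, ab.1)) :: q) (ab :: P)

/-- Backtracking search: `true` if all tables that extend `P` are found to belong to `T`. -/
def allTablesIn (N : ℕ) (T : List (List ℕ)) : ℕ → List (ℕ × ℕ) → Bool
  | 0, _ => false
  | k + 1, P =>
    match (List.range N).find? fun l => (P.lookup l).isNone with
    | none => decide ((List.range N).map (fun l => (P.lookup l).getD 0) ∈ T)
    -- The value `N` is included, for an image fixed by `z`.
    | some l => (List.range (N + 1)).all fun v =>
      match propagate N 60 [(l, v)] P with
      | none => true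
      | some P' => allTablesIn N T k P'

/-- The pairs in `P` are labels with their values under the table `t`. -/
def ValuesOf (N : ℕ) (t : ℕ → ℕ) (P : List (ℕ × ℕ)) : Prop := ∀ ab ∈ P, ab.1 < N ∧ t ab.1 = ab.2

theorem List.mem_of_lookup_eq_some {α β : Type*} [DecidableEq α] {a : α} {b : β} :
    ∀ {P : List (α × β)}, P.lookup a = some b → (a, b) ∈ P
  | [], h => by simp at h
  | (c, d) :: P, h => by
    rw [List.lookup_cons] at h
    by_cases hc : a = c
    · subst hc
      simp at h
      simp [h]
    · have : (a == c) = false := by simpa using hc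
      rw [this] at h
      exact List.mem_cons_of_mem _ (List.mem_of_lookup_eq_some h)

theorem nextLabel_lt {N : ℕ} (hN : N = 7 ∨ N = 14) {l : ℕ} (hl : l < N) : nextLabel l < N := by
  unfold nextLabel; split_ifs <;> omega

theorem prevLabel_lt {N : ℕ} (hN : N = 7 ∨ N = 14) {l : ℕ} (hl : l < N) : prevLabel l < N := by
  unfold prevLabel; split_ifs <;> omega

namespace IsTable

variable {N : ℕ} {t : ℕ → ℕ}

theorem valuesOf_forcedByTriangles (hN : N = 7 ∨ N = 14) (ht : IsTable N t) {P : List (ℕ × ℕ)}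
    (hP : ValuesOf N t P) : ValuesOf N t (forcedByTriangles N P) := by
  intro cd hcd
  obtain ⟨⟨a, b⟩, hab, h⟩ := List.mem_flatMap.1 hcd
  obtain ⟨ha, hb⟩ := hP _ hab
  dsimp only at ha hb h
  subst hb
  split_ifs at h with hb
  · simp at h
  have hb' : t a < N := lt_of_le_of_ne (ht.le a ha) hb
  cases hd : P.lookup (nextLabel (t a)) with
  | none => simp [hd] at h
  | some d =>
    obtain ⟨-, hd'⟩ := hP _ (List.mem_of_lookup_eq_some hd)
    dsimp only at hd'
    subst hd'
    simp only [hd] at h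
    split_ifs at h with hd'
    · simp at h
    have hd'' := lt_of_le_of_ne (ht.le _ (nextLabel_lt hN hb')) hd'
    have hcd' : cd = (nextLabel (t (nextLabel (t a))), prevLabel a) := by
      cases he : P.lookup (nextLabel (t (nextLabel (t a)))) with
      | none => simpa [he] using h
      | some e =>
        simp only [he] at h
        split_ifs at h
        · simp at h
        · simpa using h
    rw [hcd']
    exact ⟨nextLabel_lt hN hd'', ht.triangle a ha hb' hd''⟩

/-- Only values forced by the axioms of a table are ever adjoined, so the values of a genuine table
never lead to a contradiction. -/
theorem exists_propagate_eq_some (hN : N = 7 ∨ N = 14) (ht : IsTable N t) :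
    ∀ (k : ℕ) (q P : List (ℕ × ℕ)), ValuesOf N t q → ValuesOf N t P →
      ∃ P', propagate N k q P = some P' ∧ ValuesOf N t P'
  | 0, _, P, _, hP => ⟨P, rfl, hP⟩
  | k + 1, [], P, _, hP => by
    have hF := ht.valuesOf_forcedByTriangles hN hP
    rw [propagate]
    cases h : forcedByTriangles N P with
    | nil => exact ⟨P, rfl, hP⟩
    | cons ab q =>
      rw [h] at hF
      exact exists_propagate_eq_some hN ht k _ P hF hP
  | k + 1, (a, c) :: q, P, hq, hP => by
    have hq' : ValuesOf N t q := fun ab h => hq ab (List.mem_cons_of_mem _ h)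
    obtain ⟨ha, hc⟩ := hq _ List.mem_cons_self
    dsimp only at ha hc
    subst hc
    rw [propagate]
    cases h : P.lookup a with
    | some b =>
      obtain ⟨-, hb⟩ := hP _ (List.mem_of_lookup_eq_some h)
      dsimp only at hb
      subst hb
      simpa using exists_propagate_eq_some hN ht k q P hq' hP
    | none =>
      refine exists_propagate_eq_some hN ht k _ _ ?_ ?_
      · intro cd hcd
        rcases List.mem_cons.1 hcd with rfl | hcd
        · dsimp only
          split_ifs with hta
          · exact ⟨nextLabel_lt hN ha, ht.next_eq_prev a ha hta⟩
          · have := lt_of_le_of_ne (ht.le a ha) hta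
            exact ⟨this, ht.involutive a ha this⟩
        · exact hq' _ hcd
      · intro cd hcd
        rcases List.mem_cons.1 hcd with rfl | hcd
        · exact ⟨ha, rfl⟩
        · exact hP _ hcd

/-- Soundness of the search: the branch that follows the true values of `t` is never cut off, and it
ends with `t` itself. -/
theorem mem_of_allTablesIn (hN : N = 7 ∨ N = 14) (ht : IsTable N t) {T : List (List ℕ)} :
    ∀ (k : ℕ) (P : List (ℕ × ℕ)), ValuesOf N t P → allTablesIn N T k P = true →
      (List.range N).map t ∈ T
  | 0, _, _, h => by simp [allTablesIn] at h
  | k + 1, P, hP, h => by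
    rw [allTablesIn] at h
    cases hf : (List.range N).find? fun l => (P.lookup l).isNone with
    | none =>
      simp only [hf, decide_eq_true_eq] at h
      convert h using 1
      refine List.map_congr_left fun l hl => ?_
      have := List.find?_eq_none.1 hf l hl
      obtain ⟨b, hb⟩ : ∃ b, P.lookup l = some b := by
        rw [← Option.isSome_iff_exists]
        simpa using this
      rw [hb, (hP _ (List.mem_of_lookup_eq_some hb)).2]
      rfl
    | some l =>
      have hl : l < N := List.mem_range.1 (List.mem_of_find?_eq_some hf)
      simp only [hf, List.all_eq_true] at h
      obtain ⟨P', h1, h2⟩ := ht.exists_propagate_eq_some hN 60 [(l, t l)] P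
        (by simpa [ValuesOf] using hl) hP
      have := h (t l) (List.mem_range.2 (Nat.lt_succ_of_le (ht.le l hl)))
      simp only [h1] at this
      exact mem_of_allTablesIn hN ht k P' h2 this

end IsTable

/-! ### Rooted maps and their tables -/

/-- On a finite set the inverse of a permutation is one of its powers. -/
theorem Equiv.Perm.inv_mem_of_forall_mem {α : Type*} [Finite α] (a : Equiv.Perm α) {S : Set α}
    (h : ∀ i ∈ S, a i ∈ S) {i : α} (hi : i ∈ S) : a⁻¹ i ∈ S := by
  obtain ⟨n, hn⟩ : ∃ n : ℕ, a ^ n = a⁻¹ :=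
    mem_powers_iff_mem_zpowers.2 (inv_mem (Subgroup.mem_zpowers a))
  rw [← hn, ← Equiv.Perm.iterate_eq_pow]
  exact Set.MapsTo.iterate h n hi

namespace Dessin

theorem forall_mem_of_invariant (D : Dessin) (S : Set (Fin D.degree)) (hx : ∀ i ∈ S, D.x i ∈ S)
    (hy : ∀ i ∈ S, D.y i ∈ S) (hz : ∀ i ∈ S, D.z i ∈ S) {i : Fin D.degree} (hi : i ∈ S)
    (j : Fin D.degree) : j ∈ S := by
  have key : ∀ g ∈ Subgroup.closure {D.x, D.y, D.z}, ∀ i ∈ S, g i ∈ S := by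
    intro g hg
    induction hg using Subgroup.closure_induction with
    | mem a ha =>
      rcases ha with rfl | rfl | rfl
      · exact hx
      · exact hy
      · exact hz
    | one => exact fun i hi => hi
    | mul a b _ _ ha hb => exact fun i hi => ha _ (hb i hi)
    | inv a _ ha => exact fun i hi => Equiv.Perm.inv_mem_of_forall_mem a ha hi
  obtain ⟨g, rfl⟩ := D.transitive.exists_smul_eq i j
  exact key g g.2 i hi

/-- The edge with label `l`, if edge `u` has label `0`, and labels `0`, …, `6` and `7`, …, `13` run
along the faces of `u` and `y u`. -/
def edge (D : Dessin) (u : Fin D.degree) (l : ℕ) : Fin D.degree :=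
  if l < 7 then D.z^[l] u else D.z^[l - 7] (D.y u)

/-- The first label below `N` of an edge, or `N` if there is none. -/
def label (D : Dessin) (u : Fin D.degree) (N : ℕ) (i : Fin D.degree) : ℕ :=
  (List.range N).findIdx fun l => decide (D.edge u l = i)

/-- The involution `y` in terms of labels. -/
def table (D : Dessin) (u : Fin D.degree) (N l : ℕ) : ℕ := D.label u N (D.y (D.edge u l))

/-- Labels below `N` label exactly the edges that are not fixed by `z`, without repetitions. -/
def IsRoot (D : Dessin) (u : Fin D.degree) (N : ℕ) : Prop :=
  (∀ l < N, ∀ m < N, D.edge u l = D.edge u m → l = m) ∧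
    ∀ i, D.z i ≠ i ↔ ∃ l < N, D.edge u l = i

instance (D : Dessin) (u : Fin D.degree) (N : ℕ) : Decidable (D.IsRoot u N) :=
  inferInstanceAs (Decidable (_ ∧ _))

section HasType

variable {D D' : Dessin} {p q : ℕ}

theorem HasType.y_y (h : D.HasType 3 2 7) (i : Fin D.degree) : D.y (D.y i) = i := by
  have : D.y ^ 2 = 1 := by rw [← h.2.1, pow_orderOf_eq_one]
  simpa [pow_two] using DFunLike.congr_fun this i

theorem HasType.z_iterate (h : D.HasType 3 2 7) (i : Fin D.degree) : D.z^[7] i = i := by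
  have : D.z ^ 7 = 1 := by rw [← h.2.2, pow_orderOf_eq_one]
  rw [Equiv.Perm.iterate_eq_pow, this]
  rfl

theorem z_y_x (D : Dessin) (i : Fin D.degree) : D.z (D.y (D.x i)) = i :=
  DFunLike.congr_fun D.xyz_eq_one i

theorem HasType.zy_zy_zy (h : D.HasType 3 2 7) (i : Fin D.degree) :
    D.z (D.y (D.z (D.y (D.z (D.y i))))) = i := by
  have h3 : D.x ^ 3 = 1 := by rw [← h.1, pow_orderOf_eq_one]
  have h3' : ∀ i, D.x (D.x (D.x i)) = i := fun i => by
    simpa [pow_succ] using DFunLike.congr_fun h3 i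
  conv_lhs => rw [← h3' i]
  rw [D.z_y_x, D.z_y_x, D.z_y_x]

theorem HasType.x_eq (h : D.HasType 3 2 7) (i : Fin D.degree) :
    D.z (D.x i) = D.z (D.y (D.z⁻¹ i)) := by
  have : D.y (D.x i) = D.z⁻¹ i := by
    rw [Equiv.Perm.eq_inv_iff_eq]
    exact D.z_y_x i
  rw [← this, h.y_y]

theorem HasType.minimalPeriod (h : D.HasType 3 2 7) {i : Fin D.degree} (hi : D.z i ≠ i) :
    Function.minimalPeriod D.z i = 7 := by
  have h1 : Function.minimalPeriod D.z i ∣ 7 :=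
    Function.IsPeriodicPt.minimalPeriod_dvd (h.z_iterate i)
  rcases (Nat.dvd_prime (by norm_num)).1 h1 with h2 | h2
  · exact absurd (Function.minimalPeriod_eq_one_iff_isFixedPt.1 h2) hi
  · exact h2

theorem HasType.exists_z_ne (h : D.HasType 3 2 7) : ∃ i, D.z i ≠ i := by
  by_contra! hz
  have : D.z = 1 := Equiv.ext hz
  have := h.2.2
  simp_all

/-- If `z` fixes both i and y i, then (zy)³ i = i collapses to y i = i. Then i is fixed by the whole
group, so by transitivity it is the only edge, and `z` would be trivial. -/
theorem HasType.z_y_ne (h : D.HasType 3 2 7) {i : Fin D.degree} (hi : D.z i = i) :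
    D.z (D.y i) ≠ D.y i := by
  intro hj
  have hij : D.y i = i := by
    have := h.zy_zy_zy i
    rwa [hj, h.y_y, hi, hj] at this
  have hx : D.x i = i := by
    have := D.z_y_x i
    conv_rhs at this => rw [← hi]
    rw [← h.y_y (D.x i), D.z.injective this, hij]
  obtain ⟨j, hj⟩ := h.exists_z_ne
  have := D.forall_mem_of_invariant {i} (by simpa using hx) (by simpa using hij)
    (by simpa using hi) rfl j
  rw [Set.mem_singleton_iff.1 this] at hj
  exact hj hi

end HasType

section Root

variable {D D' : Dessin} {u : Fin D.degree} {u' : Fin D'.degree} {N : ℕ}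

theorem edge_nextLabel (h : D.HasType 3 2 7) (hN : N = 7 ∨ N = 14) {l : ℕ} (hl : l < N) :
    D.edge u (nextLabel l) = D.z (D.edge u l) := by
  have key : ∀ m < 7, ∀ i, D.z^[(m + 1) % 7] i = D.z (D.z^[m] i) := by
    intro m hm i
    rw [← Function.iterate_succ_apply' D.z]
    rcases Nat.lt_or_ge (m + 1) 7 with h7 | h7
    · rw [Nat.mod_eq_of_lt h7]
    · obtain rfl : m = 6 := by omega
      exact (h.z_iterate i).symm
  unfold edge nextLabel
  by_cases h7 : l < 7
  · rw [if_pos h7, if_pos (Nat.mod_lt _ (by norm_num)), if_pos h7, key l h7]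
  · rw [if_neg h7, if_neg (by omega), if_neg h7, ← key (l - 7) (by omega)]
    congr 2
    omega

theorem edge_prevLabel (h : D.HasType 3 2 7) (hN : N = 7 ∨ N = 14) {l : ℕ} (hl : l < N) :
    D.z (D.edge u (prevLabel l)) = D.edge u l := by
  rw [← edge_nextLabel h hN (prevLabel_lt hN hl)]
  congr 1
  unfold prevLabel nextLabel
  split_ifs <;> omega

theorem label_le (i : Fin D.degree) : D.label u N i ≤ N := by
  simpa [label] using List.findIdx_le_length (xs := List.range N)

theorem edge_label {i : Fin D.degree} (h : D.label u N i < N) : D.edge u (D.label u N i) = i := by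
  have := List.findIdx_getElem (w := (by simpa [label] using h :
    (List.range N).findIdx (fun l => decide (D.edge u l = i)) < (List.range N).length))
  simpa [label] using this

theorem edge_table {l : ℕ} (h : D.table u N l < N) :
    D.edge u (D.table u N l) = D.y (D.edge u l) := edge_label h

theorem IsRoot.label_edge (hu : D.IsRoot u N) {l : ℕ} (hl : l < N) :
    D.label u N (D.edge u l) = l := by
  have h1 : D.label u N (D.edge u l) < N := by
    have := List.findIdx_lt_length_of_exists (xs := List.range N)
      (p := fun m => decide (D.edge u m = D.edge u l)) ⟨l, by simpa using hl⟩
    simpa [label] using this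
  exact hu.1 _ h1 _ hl (edge_label h1)

theorem IsRoot.z_eq_iff (hu : D.IsRoot u N) (i : Fin D.degree) : D.z i = i ↔ D.label u N i = N := by
  constructor
  · intro hi
    by_contra hlt
    exact (hu.2 i).2 ⟨_, lt_of_le_of_ne (label_le i) hlt, edge_label
      (lt_of_le_of_ne (label_le i) hlt)⟩ hi
  · intro hi
    by_contra hz
    obtain ⟨l, hl, rfl⟩ := (hu.2 i).1 hz
    rw [hu.label_edge hl] at hi
    omega

/-- Everything but the involution is the relation (zy)³ = 1 read off at a labelled edge, with one
factor `z` cancelled. -/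
theorem IsRoot.isTable (h : D.HasType 3 2 7) (hN : N = 7 ∨ N = 14) (hu : D.IsRoot u N) :
    IsTable N (D.table u N) where
  le l _ := label_le _
  involutive l hl hlt := by
    rw [table, edge_table hlt, h.y_y, hu.label_edge hl]
  next_eq_prev l hl hlt := by
    have hi := (hu.z_eq_iff _).2 hlt
    have := h.zy_zy_zy (D.y (D.edge u l))
    conv_rhs at this => rw [← hi]
    rw [h.y_y] at this
    have h2 := congrArg D.y (D.z.injective this)
    rw [h.y_y, h.y_y, ← edge_nextLabel h hN hl, ← edge_prevLabel h hN hl] at h2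
    rw [table, D.z.injective h2, hu.label_edge (prevLabel_lt hN hl)]
  triangle l hl hlt hlt' := by
    have := h.zy_zy_zy (D.edge u l)
    rw [← edge_table hlt, ← edge_nextLabel h hN hlt, ← edge_table hlt',
      ← edge_nextLabel h hN hlt', ← edge_prevLabel h hN hl] at this
    change D.label u N (D.y _) = _
    exact (congrArg _ (D.z.injective this)).trans (hu.label_edge (prevLabel_lt hN hl))

/-- Unlabelled edges are fixed by `z`, so `y` sends them to labelled ones. -/
theorem IsRoot.cases (h : D.HasType 3 2 7) (hu : D.IsRoot u N) (i : Fin D.degree) :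
    (∃ l < N, i = D.edge u l) ∨ ∃ l < N, D.table u N l = N ∧ i = D.y (D.edge u l) := by
  by_cases hi : D.z i = i
  · right
    obtain ⟨l, hl, hl'⟩ := (hu.2 _).1 (h.z_y_ne hi)
    refine ⟨l, hl, ?_, ?_⟩
    · rw [table, hl', h.y_y, ← hu.z_eq_iff, hi]
    · rw [hl', h.y_y]
  · left
    obtain ⟨l, hl, hl'⟩ := (hu.2 _).1 hi
    exact ⟨l, hl, hl'.symm⟩

/-- The map between the edges of two dessins that respects labels, and commutes with `y`. -/
def transfer (D D' : Dessin) (u : Fin D.degree) (u' : Fin D'.degree) (N : ℕ) (i : Fin D.degree) :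
    Fin D'.degree :=
  if D.label u N i < N then D'.edge u' (D.label u N i)
  else D'.y (D'.edge u' (D.label u N (D.y i)))

theorem IsRoot.transfer_edge (hu : D.IsRoot u N) {l : ℕ} (hl : l < N) :
    transfer D D' u u' N (D.edge u l) = D'.edge u' l := by
  rw [transfer, hu.label_edge hl, if_pos hl]

theorem IsRoot.transfer_y_edge (h : D.HasType 3 2 7) (hu : D.IsRoot u N) {l : ℕ} (hl : l < N)
    (hlN : D.table u N l = N) :
    transfer D D' u u' N (D.y (D.edge u l)) = D'.y (D'.edge u' l) := by
  rw [transfer, if_neg (by rw [← table, hlN]; omega), h.y_y, hu.label_edge hl]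

/-- Matching labels, and extending by `y` to the edges fixed by `z`, gives a bijection that commutes
with `y` and `z`; `x` is determined by these two. -/
theorem IsRoot.isIso (h : D.HasType 3 2 7) (h' : D'.HasType 3 2 7) (hN : N = 7 ∨ N = 14)
    (hu : D.IsRoot u N) (hu' : D'.IsRoot u' N)
    (ht : ∀ l < N, D.table u N l = D'.table u' N l) : IsIso D D' := by
  -- Stated for arbitrary dessins so that it serves for both composites.
  have hinv : ∀ {D D' : Dessin} {u : Fin D.degree} {u' : Fin D'.degree}, D.HasType 3 2 7 →
      D'.HasType 3 2 7 → D.IsRoot u N → D'.IsRoot u' N →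
      (∀ l < N, D.table u N l = D'.table u' N l) →
      Function.LeftInverse (transfer D' D u' u N) (transfer D D' u u' N) := by
    intro D D' u u' h h' hu hu' ht i
    rcases hu.cases h i with ⟨l, hl, rfl⟩ | ⟨l, hl, hlN, rfl⟩
    · rw [hu.transfer_edge hl, hu'.transfer_edge hl]
    · rw [hu.transfer_y_edge h hl hlN, hu'.transfer_y_edge h' hl (by rw [← ht l hl, hlN])]
  let e : Fin D.degree ≃ Fin D'.degree :=
    ⟨transfer D D' u u' N, transfer D' D u' u N, hinv h h' hu hu' ht,
      hinv h' h hu' hu fun l hl => (ht l hl).symm⟩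
  have hy : ∀ i, e (D.y i) = D'.y (e i) := by
    intro i
    change transfer D D' u u' N _ = D'.y (transfer D D' u u' N _)
    rcases hu.cases h i with ⟨l, hl, rfl⟩ | ⟨l, hl, hlN, rfl⟩
    · by_cases hlN : D.table u N l = N
      · rw [hu.transfer_y_edge h hl hlN, hu.transfer_edge hl]
      · have hlt : D.table u N l < N := lt_of_le_of_ne (label_le _) hlN
        have h1 : D.y (D.edge u l) = D.edge u (D.table u N l) := (edge_label hlt).symm
        have h2 : D'.y (D'.edge u' l) = D'.edge u' (D'.table u' N l) :=
          (edge_label (by rw [← table, ← ht l hl]; exact hlt)).symm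
        rw [h1, hu.transfer_edge hlt, hu.transfer_edge hl, h2, ht l hl]
    · rw [h.y_y, hu.transfer_y_edge h hl hlN, hu.transfer_edge hl, h'.y_y]
  have hz : ∀ i, e (D.z i) = D'.z (e i) := by
    intro i
    change transfer D D' u u' N _ = D'.z (transfer D D' u u' N _)
    rcases hu.cases h i with ⟨l, hl, rfl⟩ | ⟨l, hl, hlN, rfl⟩
    · rw [← edge_nextLabel h hN hl, hu.transfer_edge hl, hu.transfer_edge (nextLabel_lt hN hl),
        edge_nextLabel h' hN hl]
    · rw [(hu.z_eq_iff _).2 hlN, hu.transfer_y_edge h hl hlN]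
      rw [ht l hl] at hlN
      rw [(hu'.z_eq_iff _).2 hlN]
  refine ⟨e, fun i => ?_, hy, hz⟩
  apply D'.y.injective
  apply D'.z.injective
  rw [D'.z_y_x, ← hy, ← hz, D.z_y_x]

theorem card_support_of_isMap327 {k : ℕ} (h : D.IsMap327 k) : D.z.support.card = 7 * k := by
  rw [← Equiv.Perm.seven_mul_count_partition h.1.2.2, ← h.2, faceCount]

theorem isRoot_of_injective (hinj : ∀ l < N, ∀ m < N, D.edge u l = D.edge u m → l = m)
    (hz : ∀ l < N, D.z (D.edge u l) ≠ D.edge u l) (hc : D.z.support.card = N) :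
    D.IsRoot u N := by
  refine ⟨hinj, fun i => ⟨fun hi => ?_, ?_⟩⟩
  · have hsub : (Finset.range N).image (D.edge u) ⊆ D.z.support := by
      intro j hj
      obtain ⟨l, hl, rfl⟩ := Finset.mem_image.1 hj
      exact Equiv.Perm.mem_support.2 (hz l (Finset.mem_range.1 hl))
    have hcard : ((Finset.range N).image (D.edge u)).card = N := by
      rw [Finset.card_image_of_injOn, Finset.card_range]
      intro l hl m hm
      exact hinj l (by simpa using hl) m (by simpa using hm)
    have := Finset.eq_of_subset_of_card_le hsub (by omega)
    have hi' : i ∈ (Finset.range N).image (D.edge u) := by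
      rw [this]
      exact Equiv.Perm.mem_support.2 hi
    simpa using hi'
  · rintro ⟨l, hl, rfl⟩
    exact hz l hl

theorem HasType.iterate_injective (h : D.HasType 3 2 7) {i : Fin D.degree} (hi : D.z i ≠ i)
    {l m : ℕ} (hl : l < 7) (hm : m < 7) (he : D.z^[l] i = D.z^[m] i) : l = m := by
  have := Function.iterate_injOn_Iio_minimalPeriod (f := D.z) (x := i)
  rw [h.minimalPeriod hi] at this
  exact this hl hm he

theorem z_iterate_ne {i : Fin D.degree} (hi : D.z i ≠ i) (l : ℕ) :
    D.z (D.z^[l] i) ≠ D.z^[l] i := by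
  rw [← Function.iterate_succ_apply' D.z, Function.iterate_succ_apply D.z]
  exact fun h => hi (D.z.injective.iterate l h)

theorem exists_isRoot_seven (h : D.IsMap327 1) : ∃ u, D.IsRoot u 7 := by
  obtain ⟨u, hu⟩ := h.1.exists_z_ne
  have he : ∀ l < 7, D.edge u l = D.z^[l] u := fun l hl => if_pos hl
  refine ⟨u, isRoot_of_injective (fun l hl m hm hlm => ?_) (fun l hl => ?_)
    (card_support_of_isMap327 h)⟩
  · rw [he l hl, he m hm] at hlm
    exact h.1.iterate_injective hu hl hm hlm
  · rw [he l hl]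
    exact z_iterate_ne hu l

/-- Let C be one face of degree 7. By connectedness some edge of C is sent by `y` into the other
face of degree 7, and it serves as the root. -/
theorem exists_isRoot_fourteen (h : D.IsMap327 2) : ∃ u, D.IsRoot u 14 := by
  obtain ⟨v, hv⟩ := h.1.exists_z_ne
  let C : Finset (Fin D.degree) := (Finset.range 7).image fun l => D.z^[l] v
  have hC : ∀ i, i ∈ C ↔ ∃ l < 7, D.z^[l] v = i := fun i => by simp [C]
  have hmod : ∀ l, D.z^[l % 7] v = D.z^[l] v := fun l => by
    rw [← h.1.minimalPeriod hv, Function.iterate_mod_minimalPeriod_eq]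
  have hC' : ∀ l, D.z^[l] v ∈ C := fun l => (hC _).2 ⟨l % 7, Nat.mod_lt _ (by norm_num), hmod l⟩
  have hCz : ∀ i ∈ C, ∀ l, D.z^[l] i ∈ C := by
    intro i hi l
    obtain ⟨m, -, rfl⟩ := (hC i).1 hi
    rw [← Function.iterate_add_apply]
    exact hC' _
  -- Otherwise the edges that lie in C or have their image under `y` in C form an invariant set,
  -- hence all edges, which leaves no room for an edge `w` on the other face.
  obtain ⟨u, hu, hyu, hyC⟩ : ∃ u ∈ C, D.z (D.y u) ≠ D.y u ∧ D.y u ∉ C := by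
    by_contra! hcon
    obtain ⟨w, hw, hwC⟩ : ∃ w ∈ D.z.support, w ∉ C := by
      by_contra! hsub
      have h1 := Finset.card_le_card hsub
      have h2 : C.card ≤ 7 := Finset.card_image_le.trans (by simp)
      rw [card_support_of_isMap327 h] at h1
      omega
    have hzS : ∀ i ∈ {i | i ∈ C ∨ D.y i ∈ C}, D.z i ∈ {i | i ∈ C ∨ D.y i ∈ C} := by
      rintro i (hi | hi)
      · exact Or.inl (hCz i hi 1)
      · by_cases hiz : D.z i = i
        · rw [hiz]
          exact Or.inr hi
        · have := hcon _ hi (by rwa [h.1.y_y])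
          rw [h.1.y_y] at this
          exact Or.inl (hCz i this 1)
    have hyS : ∀ i ∈ {i | i ∈ C ∨ D.y i ∈ C}, D.y i ∈ {i | i ∈ C ∨ D.y i ∈ C} := by
      rintro i (hi | hi)
      · right
        rwa [h.1.y_y]
      · exact Or.inl hi
    have hxS : ∀ i ∈ {i | i ∈ C ∨ D.y i ∈ C}, D.x i ∈ {i | i ∈ C ∨ D.y i ∈ C} := by
      intro i hi
      have := hyS _ (Equiv.Perm.inv_mem_of_forall_mem D.z hzS hi)
      rwa [← D.z.injective (h.1.x_eq i)] at this
    rcases D.forall_mem_of_invariant _ hxS hyS hzS (Or.inl (hC' 0)) w with hw' | hw'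
    · exact hwC hw'
    · have := hcon _ hw' (by rw [h.1.y_y]; exact Equiv.Perm.mem_support.1 hw)
      rw [h.1.y_y] at this
      exact hwC this
  have huz : D.z u ≠ u := by
    obtain ⟨l, -, rfl⟩ := (hC u).1 hu
    exact z_iterate_ne hv l
  -- Applying `z` another 7 - m times returns the right side to `y u`, which would then lie in C.
  have hdisj : ∀ l m, m ≤ 7 → D.z^[l] u ≠ D.z^[m] (D.y u) := by
    intro l m hm hlm
    apply hyC
    have := congrArg D.z^[7 - m] hlm
    rw [← Function.iterate_add_apply, ← Function.iterate_add_apply, Nat.sub_add_cancel hm,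
      h.1.z_iterate] at this
    rw [← this]
    exact hCz u hu _
  refine ⟨u, isRoot_of_injective (fun l hl m hm hlm => ?_) (fun l hl => ?_)
    (card_support_of_isMap327 h)⟩
  · unfold edge at hlm
    split_ifs at hlm with h1 h2 h2
    · exact h.1.iterate_injective huz h1 h2 hlm
    · exact absurd hlm (hdisj _ _ (by omega))
    · exact absurd hlm.symm (hdisj _ _ (by omega))
    · have := h.1.iterate_injective hyu (by omega) (by omega) hlm
      omega
  · unfold edge
    split_ifs
    · exact z_iterate_ne huz l
    · exact z_iterate_ne hyu _

theorem table_zero (hu : D.IsRoot u 14) : D.table u 14 0 = 7 := hu.label_edge (l := 7) (by norm_num)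

end Root

/-! ### The sixteen maps and completeness of the list -/

/-- The dessin with given `x` of order `3` and `y` of order `2`, as functions. -/
def ofFun {n : ℕ} (a : Fin n) (x y : Fin n → Fin n) (hx : ∀ i, x (x (x i)) = i)
    (hy : ∀ i, y (y i) = i) (h : ∀ i, i ∈ (orbitStep x y)^[10] {a}) : Dessin where
  degree := n
  degree_pos := a.pos
  x := ⟨x, fun i => x (x i), hx, hx⟩
  y := ⟨y, y, hy, hy⟩
  -- Since `z * y * x = 1`, `z` is x⁻¹y⁻¹, and here x⁻¹ = x² and y⁻¹ = y.
  z := ⟨fun i => x (x (y i)), fun i => y (x i), fun i => by simp only [hx, hy],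
    fun i => by simp only [hx, hy]⟩
  xyz_eq_one := by
    ext i
    simp [hx, hy]
  transitive := isPretransitive_of_forall_exists a fun b =>
    exists_of_mem_orbitStep_iterate (x := ⟨x, fun i => x (x i), hx, hx⟩) (y := ⟨y, y, hy, hy⟩)
      (Subgroup.subset_closure (by simp)) (Subgroup.subset_closure (by simp)) a 10 b (h b)

/-- Representatives of the `(3,2,7)`-maps with one face of degree `7`. -/
def mapOneFace : Fin 4 → Dessin := ![
  -- In the two trees edge i stands for the point of the Fano plane with binary code i + 1. In the
  -- two other maps the edges are the points of a projective line, with infinity as the last.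
  ofFun (n := 7) 0
    ![3, 0, 4, 1, 5, 2, 6]
    ![0, 5, 6, 3, 4, 1, 2]
    (by decide +kernel) (by decide +kernel) (by decide +kernel),
  ofFun (n := 7) 0
    ![1, 3, 5, 0, 2, 4, 6]
    ![0, 5, 6, 3, 4, 1, 2]
    (by decide +kernel) (by decide +kernel) (by decide +kernel),
  ofFun (n := 8) 0
    ![6, 3, 2, 5, 4, 1, 7, 0]
    ![7, 6, 3, 2, 5, 4, 1, 0]
    (by decide +kernel) (by decide +kernel) (by decide +kernel),
  ofFun (n := 9) 0
    ![3, 7, 5, 8, 2, 4, 1, 6, 0]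
    ![8, 1, 5, 6, 7, 2, 3, 4, 0]
    (by decide +kernel) (by decide +kernel) (by decide +kernel)]

/-- Representatives of the `(3,2,7)`-maps with two faces of degree `7`. -/
def mapTwoFaces : Fin 12 → Dessin := ![
  -- Three maps on the projective line over `ZMod 13`, where 13 is infinity and `y` is t ↦ -1/t.
  ofFun (n := 14) 0
    ![12, 1, 7, 13, 9, 2, 4, 5, 3, 6, 10, 0, 11, 8]
    ![13, 12, 6, 4, 3, 5, 2, 11, 8, 10, 9, 7, 1, 0]
    (by decide +kernel) (by decide +kernel) (by decide +kernel),
  ofFun (n := 14) 0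
    ![4, 1, 2, 10, 6, 11, 0, 13, 5, 7, 12, 8, 3, 9]
    ![13, 12, 6, 4, 3, 5, 2, 11, 8, 10, 9, 7, 1, 0]
    (by decide +kernel) (by decide +kernel) (by decide +kernel),
  ofFun (n := 14) 0
    ![0, 8, 4, 9, 11, 13, 3, 5, 10, 6, 1, 2, 12, 7]
    ![13, 12, 6, 4, 3, 5, 2, 11, 8, 10, 9, 7, 1, 0]
    (by decide +kernel) (by decide +kernel) (by decide +kernel),
  -- Four maps on the imaginary octonion units, where i and i + 7 are opposite.
  ofFun (n := 14) 0
    ![9, 7, 1, 13, 10, 5, 4, 2, 0, 8, 6, 3, 12, 11]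
    ![7, 1, 13, 10, 5, 4, 9, 0, 8, 6, 3, 12, 11, 2]
    (by decide +kernel) (by decide +kernel) (by decide +kernel),
  ofFun (n := 14) 0
    ![8, 2, 7, 11, 6, 5, 10, 1, 9, 0, 4, 13, 12, 3]
    ![7, 1, 13, 10, 5, 4, 9, 0, 8, 6, 3, 12, 11, 2]
    (by decide +kernel) (by decide +kernel) (by decide +kernel),
  ofFun (n := 14) 0
    ![5, 4, 8, 7, 9, 10, 6, 12, 11, 1, 0, 2, 3, 13]
    ![7, 1, 13, 10, 5, 4, 9, 0, 8, 6, 3, 12, 11, 2]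
    (by decide +kernel) (by decide +kernel) (by decide +kernel),
  ofFun (n := 14) 0
    ![10, 5, 0, 9, 4, 13, 8, 3, 12, 7, 2, 11, 6, 1]
    ![7, 1, 13, 10, 5, 4, 9, 0, 8, 6, 3, 12, 11, 2]
    (by decide +kernel) (by decide +kernel) (by decide +kernel),
  -- Two maps on the oriented lines of the Fano plane, where i and i + 7 are the two orientations of
  -- a line.
  ofFun (n := 14) 0
    ![8, 10, 12, 0, 2, 11, 6, 1, 3, 5, 7, 9, 4, 13]
    ![2, 1, 0, 10, 13, 12, 11, 9, 8, 7, 3, 6, 5, 4]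
    (by decide +kernel) (by decide +kernel) (by decide +kernel),
  ofFun (n := 14) 0
    ![3, 7, 4, 8, 12, 9, 6, 10, 0, 11, 1, 5, 2, 13]
    ![2, 1, 0, 10, 13, 12, 11, 9, 8, 7, 3, 6, 5, 4]
    (by decide +kernel) (by decide +kernel) (by decide +kernel),
  ofFun (n := 15) 0
    ![11, 7, 1, 13, 3, 12, 5, 2, 0, 10, 14, 8, 6, 4, 9]
    ![7, 1, 13, 3, 12, 5, 11, 0, 10, 14, 8, 6, 4, 2, 9]
    (by decide +kernel) (by decide +kernel) (by decide +kernel),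
  ofFun (n := 15) 0
    ![12, 7, 1, 13, 5, 14, 3, 2, 0, 11, 9, 10, 8, 6, 4]
    ![7, 1, 13, 5, 14, 3, 12, 0, 11, 9, 10, 8, 6, 2, 4]
    (by decide +kernel) (by decide +kernel) (by decide +kernel),
  ofFun (n := 15) 0
    ![4, 7, 1, 13, 8, 6, 14, 2, 0, 3, 12, 10, 11, 9, 5]
    ![7, 1, 13, 8, 6, 14, 4, 0, 3, 12, 10, 11, 9, 2, 5]
    (by decide +kernel) (by decide +kernel) (by decide +kernel)]

/-- The possible tables, each with the index of a map and an edge of it that give that table. -/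
def tablesOneFace : List (List ℕ × ℕ × ℕ) := [
  ([0, 1, 6, 3, 5, 4, 2], 0, 3),
  ([0, 1, 6, 4, 3, 5, 2], 1, 0),
  ([0, 2, 1, 6, 4, 5, 3], 0, 4),
  ([0, 3, 7, 1, 6, 7, 4], 3, 1),
  ([0, 4, 2, 3, 1, 6, 5], 1, 4),
  ([0, 5, 2, 4, 3, 1, 6], 0, 0),
  ([0, 5, 3, 2, 4, 1, 6], 1, 3),
  ([1, 0, 2, 6, 4, 5, 3], 1, 2),
  ([1, 0, 3, 2, 6, 7, 4], 2, 5),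
  ([1, 0, 4, 7, 2, 6, 5], 2, 3),
  ([1, 0, 5, 3, 4, 2, 6], 0, 2),
  ([2, 7, 0, 3, 6, 7, 4], 3, 7),
  ([2, 7, 0, 4, 3, 6, 5], 2, 1),
  ([2, 7, 0, 5, 7, 3, 6], 3, 6),
  ([3, 1, 2, 0, 4, 6, 5], 0, 5),
  ([3, 1, 2, 0, 5, 4, 6], 1, 5),
  ([4, 1, 3, 2, 0, 5, 6], 0, 1),
  ([4, 2, 1, 3, 0, 5, 6], 1, 1),
  ([5, 1, 4, 7, 2, 0, 7], 3, 4),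
  ([5, 2, 1, 4, 3, 0, 7], 2, 6),
  ([5, 3, 7, 1, 4, 0, 7], 3, 3),
  ([6, 1, 5, 3, 4, 2, 0], 1, 6),
  ([6, 2, 1, 5, 7, 3, 0], 2, 4),
  ([6, 3, 7, 1, 5, 4, 0], 2, 2),
  ([6, 4, 2, 3, 1, 5, 0], 0, 6),
  ([7, 6, 2, 5, 7, 3, 1], 3, 5),
  ([7, 6, 3, 2, 5, 4, 1], 2, 0),
  ([7, 6, 4, 7, 2, 5, 1], 3, 0)]

/-- The possible tables, each with the index of a map and an edge of it that give that table. -/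
def tablesTwoFaces : List (List ℕ × ℕ × ℕ) := [
  ([7, 1, 13, 3, 12, 5, 11, 0, 10, 14, 8, 6, 4, 2], 9, 0),
  ([7, 1, 13, 3, 12, 8, 6, 0, 5, 11, 14, 9, 4, 2], 9, 2),
  ([7, 1, 13, 4, 3, 12, 9, 0, 8, 6, 11, 10, 5, 2], 7, 3),
  ([7, 1, 13, 4, 3, 12, 10, 0, 9, 8, 6, 11, 5, 2], 0, 6),
  ([7, 1, 13, 5, 14, 3, 12, 0, 11, 9, 10, 8, 6, 2], 10, 0),
  ([7, 1, 13, 8, 6, 14, 4, 0, 3, 12, 10, 11, 9, 2], 11, 0),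
  ([7, 1, 13, 9, 4, 8, 6, 0, 5, 3, 12, 14, 10, 2], 9, 4),
  ([7, 1, 13, 10, 5, 4, 9, 0, 8, 6, 3, 12, 11, 2], 3, 0),
  ([7, 1, 13, 10, 8, 6, 5, 0, 4, 9, 3, 12, 11, 2], 0, 4),
  ([7, 1, 13, 11, 5, 4, 10, 0, 9, 8, 6, 3, 12, 2], 4, 6),
  ([7, 1, 13, 11, 8, 6, 5, 0, 4, 10, 9, 3, 12, 2], 8, 2),
  ([7, 2, 1, 13, 4, 12, 9, 0, 8, 6, 11, 10, 5, 3], 0, 2),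
  ([7, 2, 1, 13, 4, 12, 10, 0, 9, 8, 6, 11, 5, 3], 8, 5),
  ([7, 2, 1, 13, 5, 4, 12, 0, 11, 9, 10, 8, 6, 3], 1, 13),
  ([7, 2, 1, 13, 8, 6, 5, 0, 4, 12, 10, 11, 9, 3], 1, 4),
  ([7, 2, 1, 13, 10, 5, 9, 0, 8, 6, 4, 12, 11, 3], 4, 2),
  ([7, 2, 1, 13, 10, 8, 6, 0, 5, 9, 4, 12, 11, 3], 7, 0),
  ([7, 2, 1, 13, 11, 5, 10, 0, 9, 8, 6, 4, 12, 3], 3, 3),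
  ([7, 2, 1, 13, 11, 8, 6, 0, 5, 10, 9, 4, 12, 3], 0, 7),
  ([7, 3, 14, 1, 13, 5, 12, 0, 11, 9, 10, 8, 6, 4], 11, 3),
  ([7, 3, 14, 1, 13, 8, 6, 0, 5, 12, 10, 11, 9, 4], 10, 2),
  ([7, 3, 14, 1, 13, 11, 9, 0, 8, 6, 10, 5, 12, 4], 9, 7),
  ([7, 4, 2, 3, 1, 13, 9, 0, 8, 6, 12, 14, 10, 5], 10, 7),
  ([7, 4, 2, 3, 1, 13, 10, 0, 9, 8, 6, 12, 11, 5], 1, 0),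
  ([7, 4, 2, 3, 1, 13, 11, 0, 10, 14, 8, 6, 12, 5], 11, 8),
  ([7, 5, 2, 4, 3, 1, 13, 0, 12, 9, 11, 10, 8, 6], 5, 3),
  ([7, 5, 2, 4, 3, 1, 13, 0, 12, 10, 9, 11, 8, 6], 2, 2),
  ([7, 5, 3, 2, 4, 1, 13, 0, 12, 9, 11, 10, 8, 6], 2, 6),
  ([7, 5, 3, 2, 4, 1, 13, 0, 12, 10, 9, 11, 8, 6], 6, 0),
  ([7, 8, 6, 3, 5, 4, 2, 0, 1, 13, 10, 12, 11, 9], 5, 0),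
  ([7, 8, 6, 3, 5, 4, 2, 0, 1, 13, 11, 10, 12, 9], 2, 3),
  ([7, 8, 6, 4, 3, 5, 2, 0, 1, 13, 10, 12, 11, 9], 2, 4),
  ([7, 8, 6, 4, 3, 5, 2, 0, 1, 13, 11, 10, 12, 9], 6, 3),
  ([7, 9, 2, 8, 6, 14, 4, 0, 3, 1, 13, 11, 12, 10], 10, 6),
  ([7, 9, 3, 2, 8, 6, 5, 0, 4, 1, 13, 11, 12, 10], 1, 10),
  ([7, 9, 4, 14, 2, 8, 6, 0, 5, 1, 13, 11, 12, 10], 11, 2),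
  ([7, 10, 2, 9, 4, 8, 6, 0, 5, 3, 1, 13, 14, 11], 9, 6),
  ([7, 10, 5, 3, 4, 2, 9, 0, 8, 6, 1, 13, 14, 11], 11, 7),
  ([7, 10, 8, 6, 4, 5, 3, 0, 2, 9, 1, 13, 14, 11], 10, 12),
  ([7, 11, 2, 10, 5, 4, 9, 0, 8, 6, 3, 1, 13, 12], 0, 3),
  ([7, 11, 2, 10, 8, 6, 5, 0, 4, 9, 3, 1, 13, 12], 4, 3),
  ([7, 11, 3, 2, 10, 5, 9, 0, 8, 6, 4, 1, 13, 12], 8, 0),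
  ([7, 11, 3, 2, 10, 8, 6, 0, 5, 9, 4, 1, 13, 12], 3, 2),
  ([7, 11, 5, 3, 4, 2, 10, 0, 9, 8, 6, 1, 13, 12], 1, 3),
  ([7, 11, 8, 6, 4, 5, 3, 0, 2, 10, 9, 1, 13, 12], 1, 9),
  ([7, 11, 9, 3, 8, 6, 5, 0, 4, 2, 10, 1, 13, 12], 7, 5),
  ([7, 11, 9, 4, 3, 8, 6, 0, 5, 2, 10, 1, 13, 12], 0, 13),
  ([7, 12, 2, 11, 5, 4, 10, 0, 9, 8, 6, 3, 1, 13], 7, 2),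
  ([7, 12, 2, 11, 8, 6, 5, 0, 4, 10, 9, 3, 1, 13], 3, 6),
  ([7, 12, 3, 2, 11, 5, 10, 0, 9, 8, 6, 4, 1, 13], 0, 11),
  ([7, 12, 3, 2, 11, 8, 6, 0, 5, 10, 9, 4, 1, 13], 4, 0),
  ([7, 12, 4, 14, 2, 11, 9, 0, 8, 6, 10, 5, 1, 13], 9, 13),
  ([7, 12, 5, 3, 4, 2, 11, 0, 10, 14, 8, 6, 1, 13], 10, 13),
  ([7, 12, 8, 6, 4, 5, 3, 0, 2, 11, 14, 9, 1, 13], 11, 13),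
  ([7, 12, 9, 3, 8, 6, 5, 0, 4, 2, 11, 10, 1, 13], 0, 0),
  ([7, 12, 9, 4, 3, 8, 6, 0, 5, 2, 11, 10, 1, 13], 8, 3),
  ([7, 12, 10, 5, 14, 3, 9, 0, 8, 6, 2, 11, 1, 13], 9, 12),
  ([7, 12, 10, 8, 6, 14, 4, 0, 3, 9, 2, 11, 1, 13], 9, 11)]

/-- Each level of the search settles at least one label, so seven labels and the final check need
depth at most 8. -/
theorem allTablesIn_tablesOneFace :
    allTablesIn 7 (tablesOneFace.map Prod.fst) 8 [] = true := by decide +kernel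

/-- With the value at 0 given, thirteen labels and the final check need depth at most 14. -/
theorem allTablesIn_tablesTwoFaces :
    allTablesIn 14 (tablesTwoFaces.map Prod.fst) 14 [(0, 7)] = true := by decide +kernel

theorem exists_isRoot_of_mem_tablesOneFace : ∀ h ∈ tablesOneFace, ∃ i : Fin 4, (i : ℕ) = h.2.1 ∧
    ∃ u : Fin (mapOneFace i).degree, (u : ℕ) = h.2.2 ∧ (mapOneFace i).IsRoot u 7 ∧
      (List.range 7).map ((mapOneFace i).table u 7) = h.1 := by decide +kernel

theorem exists_isRoot_of_mem_tablesTwoFaces : ∀ h ∈ tablesTwoFaces, ∃ i : Fin 12, (i : ℕ) = h.2.1 ∧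
    ∃ u : Fin (mapTwoFaces i).degree, (u : ℕ) = h.2.2 ∧ (mapTwoFaces i).IsRoot u 14 ∧
      (List.range 14).map ((mapTwoFaces i).table u 14) = h.1 := by decide +kernel

theorem hasType_of_apply {D : Dessin} (hx : (∀ i, D.x (D.x (D.x i)) = i) ∧ ∃ i, D.x i ≠ i)
    (hy : (∀ i, D.y (D.y i) = i) ∧ ∃ i, D.y i ≠ i)
    (hz : (∀ i, D.z^[7] i = i) ∧ ∃ i, D.z i ≠ i) : D.HasType 3 2 7 := by
  have hne : ∀ {a : Equiv.Perm (Fin D.degree)}, (∃ i, a i ≠ i) → a ≠ 1 := by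
    rintro a ⟨i, hi⟩ rfl
    exact hi rfl
  have : Fact (Nat.Prime 7) := ⟨by norm_num⟩
  refine ⟨orderOf_eq_prime (Equiv.ext fun i => ?_) (hne hx.2),
    orderOf_eq_prime (Equiv.ext fun i => ?_) (hne hy.2),
    orderOf_eq_prime (Equiv.ext fun i => ?_) (hne hz.2)⟩
  · simpa [pow_succ] using hx.1 i
  · simpa [pow_succ] using hy.1 i
  · rw [← Equiv.Perm.iterate_eq_pow]
    exact hz.1 i

theorem isMap327_of_apply {D : Dessin} {k : ℕ} (h : D.HasType 3 2 7)
    (hk : (Finset.univ.filter fun i => D.z i ≠ i).card = 7 * k) : D.IsMap327 k := by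
  refine ⟨h, ?_⟩
  have := Equiv.Perm.seven_mul_count_partition h.2.2
  rw [Equiv.Perm.support, hk] at this
  rw [faceCount]
  omega

theorem isMap327_mapOneFace (i : Fin 4) : (mapOneFace i).IsMap327 1 := by
  revert i
  have h1 : ∀ i, (∀ j, (mapOneFace i).x ((mapOneFace i).x ((mapOneFace i).x j)) = j) ∧
      ∃ j, (mapOneFace i).x j ≠ j := by decide +kernel
  have h2 : ∀ i, (∀ j, (mapOneFace i).y ((mapOneFace i).y j) = j) ∧
      ∃ j, (mapOneFace i).y j ≠ j := by decide +kernel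
  have h3 : ∀ i, (∀ j, (mapOneFace i).z^[7] j = j) ∧
      ∃ j, (mapOneFace i).z j ≠ j := by decide +kernel
  have h4 : ∀ i, (Finset.univ.filter fun j => (mapOneFace i).z j ≠ j).card = 7 * 1 := by
    decide +kernel
  exact fun i => isMap327_of_apply (hasType_of_apply (h1 i) (h2 i) (h3 i)) (h4 i)

theorem isMap327_mapTwoFaces (i : Fin 12) : (mapTwoFaces i).IsMap327 2 := by
  revert i
  have h1 : ∀ i, (∀ j, (mapTwoFaces i).x ((mapTwoFaces i).x ((mapTwoFaces i).x j)) = j) ∧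
      ∃ j, (mapTwoFaces i).x j ≠ j := by decide +kernel
  have h2 : ∀ i, (∀ j, (mapTwoFaces i).y ((mapTwoFaces i).y j) = j) ∧
      ∃ j, (mapTwoFaces i).y j ≠ j := by decide +kernel
  have h3 : ∀ i, (∀ j, (mapTwoFaces i).z^[7] j = j) ∧
      ∃ j, (mapTwoFaces i).z j ≠ j := by decide +kernel
  have h4 : ∀ i, (Finset.univ.filter fun j => (mapTwoFaces i).z j ≠ j).card = 7 * 2 := by
    decide +kernel
  exact fun i => isMap327_of_apply (hasType_of_apply (h1 i) (h2 i) (h3 i)) (h4 i)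

theorem IsRoot.isIso_of_map_table_eq {D D' : Dessin} {u : Fin D.degree} {u' : Fin D'.degree}
    {N : ℕ} (h : D.HasType 3 2 7) (h' : D'.HasType 3 2 7) (hN : N = 7 ∨ N = 14)
    (hu : D.IsRoot u N) (hu' : D'.IsRoot u' N)
    (ht : (List.range N).map (D'.table u' N) = (List.range N).map (D.table u N)) : IsIso D D' :=
  hu.isIso h h' hN hu' fun l hl => (List.map_inj_left.1 ht l (List.mem_range.2 hl)).symm

theorem exists_isIso_mapOneFace {D : Dessin} (h : D.IsMap327 1) :
    ∃ i, IsIso D (mapOneFace i) := by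
  obtain ⟨u, hu⟩ := exists_isRoot_seven h
  have ht := (hu.isTable h.1 (Or.inl rfl)).mem_of_allTablesIn (Or.inl rfl) 8 []
    (by simp [ValuesOf]) allTablesIn_tablesOneFace
  obtain ⟨a, ha, hau⟩ := List.mem_map.1 ht
  obtain ⟨i, -, u', -, hu', ht'⟩ := exists_isRoot_of_mem_tablesOneFace a ha
  exact ⟨i, hu.isIso_of_map_table_eq h.1 (isMap327_mapOneFace i).1 (Or.inl rfl) hu'
    (ht'.trans hau)⟩

theorem exists_isIso_mapTwoFaces {D : Dessin} (h : D.IsMap327 2) :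
    ∃ i, IsIso D (mapTwoFaces i) := by
  obtain ⟨u, hu⟩ := exists_isRoot_fourteen h
  have ht := (hu.isTable h.1 (Or.inr rfl)).mem_of_allTablesIn (Or.inr rfl) 14 [(0, 7)]
    (by simpa [ValuesOf] using table_zero hu) allTablesIn_tablesTwoFaces
  obtain ⟨a, ha, hau⟩ := List.mem_map.1 ht
  obtain ⟨i, -, u', -, hu', ht'⟩ := exists_isRoot_of_mem_tablesTwoFaces a ha
  exact ⟨i, hu.isIso_of_map_table_eq h.1 (isMap327_mapTwoFaces i).1 (Or.inr rfl) hu'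
    (ht'.trans hau)⟩

/-! ### The listed maps are pairwise non-isomorphic -/

/-- The words `ws` in the monodromy permutations `x` and `y` have a common fixed point. -/
def HasCommonFixedPoint (ws : List (List ℕ)) (D : Dessin) : Prop :=
  ∃ i, ∀ w ∈ ws, wordValue D.x D.y w i = i

instance (ws : List (List ℕ)) (D : Dessin) : Decidable (HasCommonFixedPoint ws D) :=
  inferInstanceAs (Decidable (∃ _, _))

theorem apply_wordValue {α β : Type*} {x y : Equiv.Perm α} {x' y' : Equiv.Perm β} {e : α → β}
    (hx : ∀ i, e (x i) = x' (e i)) (hy : ∀ i, e (y i) = y' (e i)) :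
    ∀ w i, e (wordValue x y w i) = wordValue x' y' w (e i)
  | [], _ => rfl
  | 0 :: w, i => by
    simp only [wordValue, Equiv.Perm.mul_apply, hx, apply_wordValue hx hy w i]
  | (_ + 1) :: w, i => by
    simp only [wordValue, Equiv.Perm.mul_apply, hy, apply_wordValue hx hy w i]

theorem invariant_hasCommonFixedPoint (ws : List (List ℕ)) :
    Invariant (HasCommonFixedPoint ws) := by
  rintro D D' ⟨e, hx, hy, -⟩ ⟨i, hi⟩
  exact ⟨e i, fun w hw => by rw [← apply_wordValue hx hy, hi w hw]⟩

/-- Words that have a common fixed point in only one of the maps. -/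
def fixingWordsOneFace : Fin 4 → List (List ℕ) := ![
  [[1, 0, 1], [0, 0, 1, 0]],
  [[1, 0, 1], [0, 1, 0, 0]],
  [[1, 0, 1], [0, 1, 0, 1, 0, 0]],
  [[0, 1, 0, 0], [1, 0, 1, 0, 1]]]

/-- Words that have a common fixed point in only one of the maps. -/
def fixingWordsTwoFaces : Fin 12 → List (List ℕ) := ![
  [[1, 0, 1, 0, 1, 0, 0, 1, 0, 0], [0, 0, 1, 0, 1, 0], [1, 0, 0, 1, 0, 1]],
  [[0, 1, 0, 1, 0, 0], [1, 0, 1, 0, 0, 1, 0]],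
  [[1, 0, 0, 1, 0], [0, 1, 0, 0, 1, 0, 1, 0, 0], [1, 0, 1, 0, 1, 0, 0, 1, 0, 1, 0]],
  [[1, 0, 1, 0, 0, 1, 0, 1, 0, 0], [1, 0, 0, 1, 0, 1, 0, 0, 1, 0], [0, 1, 0, 0]],
  [[1, 0, 1, 0, 0, 1, 0, 1, 0, 0], [0, 0, 1, 0], [1, 0, 0, 1, 0, 1]],
  [[1, 0, 1, 0, 0], [0, 0, 1, 0, 1, 0, 0, 1, 0], [1, 0, 0, 1, 0, 1, 0, 0, 1, 0, 1]],
  [[1, 0, 0, 1, 0], [0, 1, 0, 0, 1, 0, 1, 0, 0], [1, 0, 1, 0, 0, 1, 0, 1, 0, 1, 0]],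
  [[1, 0, 0, 1, 0, 1, 0, 1], [0, 1, 0, 0, 1, 0, 1, 0, 0]],
  [[1, 0, 1, 0, 1, 0, 0, 1], [0, 0, 1, 0, 1, 0, 0, 1, 0]],
  [[0, 0, 1, 0], [1, 0, 1, 0, 0, 1]],
  [[1, 0, 0, 1, 0, 1], [1, 0, 1, 0, 0, 1, 0]],
  [[1, 0, 0, 1, 0, 1], [1, 0, 1, 0, 1, 0, 0]]]

/-- An isomorphism carries common fixed points of words along, so each list of words is an invariant
that singles out its map. -/
theorem eq_of_isIso_mapOneFace (i j : Fin 4) (h : IsIso (mapOneFace i) (mapOneFace j)) :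
    i = j := by
  have h1 : ∀ i, HasCommonFixedPoint (fixingWordsOneFace i) (mapOneFace i) := by decide +kernel
  have h2 : ∀ i j, HasCommonFixedPoint (fixingWordsOneFace i) (mapOneFace j) → i = j := by
    decide +kernel
  exact h2 i j (invariant_hasCommonFixedPoint _ _ _ h (h1 i))

theorem eq_of_isIso_mapTwoFaces (i j : Fin 12) (h : IsIso (mapTwoFaces i) (mapTwoFaces j)) :
    i = j := by
  have h1 : ∀ i, HasCommonFixedPoint (fixingWordsTwoFaces i) (mapTwoFaces i) := by decide +kernel
  have h2 : ∀ i j, HasCommonFixedPoint (fixingWordsTwoFaces i) (mapTwoFaces j) → i = j := by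
    decide +kernel
  exact h2 i j (invariant_hasCommonFixedPoint _ _ _ h (h1 i))

end Dessin

/-! ### Recognition of projective special linear groups -/

open scoped LinearAlgebra.Projectivization in
theorem Projectivization.smul_mk_eq_mk {ι K : Type*} [Fintype ι] [DecidableEq ι] [Field K]
    {A : Matrix.SpecialLinearGroup ι K} {v w : ι → K} (hv : v ≠ 0) (hw : w ≠ 0)
    (h : ∃ c : K, c • w = A.1.mulVec v) :
    A • Projectivization.mk K v hv = Projectivization.mk K w hw := by
  rw [Projectivization.smul_mk, Projectivization.mk_eq_mk_iff']
  exact h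

namespace Matrix.SpecialLinearGroup

variable {ι K : Type*} [Fintype ι] [DecidableEq ι] [Field K]

/-- Transvections in a fixed position add their coefficients, so additive generators of the field
suffice. -/
theorem transvection_mem_of_closure_eq_top {H : Subgroup (SpecialLinearGroup ι K)} {B : Set K}
    (hB : AddSubgroup.closure B = ⊤) {i j : ι} (hij : i ≠ j)
    (h : ∀ b ∈ B, transvection hij b ∈ H) (c : K) : transvection hij c ∈ H := by
  have hc : c ∈ AddSubgroup.closure B := by rw [hB]; trivial
  induction hc using AddSubgroup.closure_induction with
  | mem b hb => exact h b hb
  | zero => rw [transvection_coeff_zero]; exact H.one_mem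
  | add a b _ _ ha hb => rw [transvection_add]; exact H.mul_mem ha hb
  | neg a _ ha => rw [← transvection_inv]; exact H.inv_mem ha

theorem eq_top_of_transvection_mem_two {H : Subgroup (SpecialLinearGroup (Fin 2) K)} {B : Set K}
    (hB : AddSubgroup.closure B = ⊤)
    (h : ∀ (i j : Fin 2) (hij : i ≠ j), ∀ b ∈ B, transvection hij b ∈ H) : H = ⊤ :=
  eq_top_iff.2 fun A _ => SL2.transvection_induction (· ∈ H)
    (fun i j hij c => transvection_mem_of_closure_eq_top hB hij (h i j hij) c)
    (fun _ _ => H.mul_mem) A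

/-- Over two elements the only unit is 1, so the diagonal generators are trivial. -/
theorem eq_top_of_transvection_mem_zmod_two {n : ℕ} [Nontrivial (Fin n)]
    {H : Subgroup (SpecialLinearGroup (Fin n) (ZMod 2))}
    (h : ∀ (i j : Fin n) (hij : i ≠ j), transvection hij 1 ∈ H) : H = ⊤ := by
  have hc : ∀ c : ZMod 2, c = 0 ∨ c = 1 := by decide
  refine eq_top_iff.2 fun A _ => diagonal_transvection_induction' (· ∈ H) A
    (fun i j hij c hc0 => ?_) (fun i j hij c => ?_) (fun _ _ => H.mul_mem)
  · rcases hc c with rfl | rfl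
    · exact absurd rfl hc0
    · convert H.one_mem
      ext k l
      rw [diag2n_coe]
      simp only [inv_one, coe_one]
      rw [Matrix.one_apply, Matrix.diagonal_apply]
      split_ifs <;> rfl
  · rcases hc c with rfl | rfl
    · rw [transvection_coeff_zero]
      exact H.one_mem
    · exact h i j hij

/-- An isomorphism of rings induces an isomorphism of special linear groups. -/
def mapEquiv {R S : Type*} [CommRing R] [CommRing S] (e : R ≃+* S) :
    SpecialLinearGroup ι R ≃* SpecialLinearGroup ι S where
  toFun := map (e : R →+* S)
  invFun := map (e.symm : S →+* R)
  left_inv A := by ext i j; simp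
  right_inv A := by ext i j; simp
  map_mul' := map_mul _

end Matrix.SpecialLinearGroup

theorem MulEquiv.map_center_eq {G H : Type*} [Group G] [Group H] (e : G ≃* H) :
    (Subgroup.center G).map (e : G →* H) = Subgroup.center H := by
  ext h
  rw [Subgroup.mem_map]
  simp only [Subgroup.mem_center_iff]
  constructor
  · rintro ⟨g, hg, rfl⟩ k
    have := congrArg e (hg (e.symm k))
    simpa using this
  · intro hh
    refine ⟨e.symm h, fun k => ?_, by simp⟩
    have := congrArg e.symm (hh (e k))
    simpa using this

namespace Dessin

theorem monodromyGroup_eq (D : Dessin) : D.monodromyGroup = Subgroup.closure {D.x, D.y} := by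
  apply le_antisymm
  · rw [monodromyGroup, Subgroup.closure_le]
    have hx : D.x ∈ Subgroup.closure {D.x, D.y} := Subgroup.subset_closure (by simp)
    have hy : D.y ∈ Subgroup.closure {D.x, D.y} := Subgroup.subset_closure (by simp)
    rintro a (rfl | rfl | rfl)
    · exact hx
    · exact hy
    · have : D.z = (D.y * D.x)⁻¹ := by
        rw [eq_inv_iff_mul_eq_one, ← mul_assoc]
        exact D.xyz_eq_one
      rw [this]
      exact inv_mem (mul_mem hy hx)
  · exact Subgroup.closure_mono (by intro a ha; rcases ha with rfl | rfl <;> simp)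

theorem x_mem_monodromyGroup (D : Dessin) : D.x ∈ D.monodromyGroup :=
  Subgroup.subset_closure (by simp)

theorem y_mem_monodromyGroup (D : Dessin) : D.y ∈ D.monodromyGroup :=
  Subgroup.subset_closure (by simp)

/-- If the edges of `D` embed into a set with an action of `R`, so that generators of `R` act as
`x` and `y`, and the centre of `R` is the kernel of the action on the image, then the monodromy
group is the quotient of `R` by its centre. -/
theorem nonempty_monodromyGroup_equiv_quotient_center {R Y : Type*} [Group R] [MulAction R Y]
    (D : Dessin) (f : Fin D.degree → Y) (hf : Function.Injective f) {a b : R}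
    (hab : Subgroup.closure {a, b} = ⊤) (ha : ∀ i, a • f i = f (D.x i))
    (hb : ∀ i, b • f i = f (D.y i))
    (hker : ∀ r, (∀ i, r • f i = f i) ↔ r ∈ Subgroup.center R) :
    Nonempty (D.monodromyGroup ≃* R ⧸ Subgroup.center R) := by
  have hex : ∀ r : R, ∀ i, ∃ j, r • f i = f j := by
    intro r
    have hr : r ∈ Subgroup.closure {a, b} := by rw [hab]; trivial
    -- The claim is carried for `r` and its inverse together, so that the inversion case of the
    -- induction closes.
    have hinv : ∀ r ∈ Subgroup.closure {a, b}, (∀ i, ∃ j, r • f i = f j) ∧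
        ∀ i, ∃ j, r⁻¹ • f i = f j := by
      intro r hr
      induction hr using Subgroup.closure_induction with
      | mem c hc =>
        rcases hc with rfl | rfl
        · exact ⟨fun i => ⟨_, ha i⟩, fun i => ⟨D.x⁻¹ i, by
            rw [inv_smul_eq_iff, ha]; simp⟩⟩
        · exact ⟨fun i => ⟨_, hb i⟩, fun i => ⟨D.y⁻¹ i, by
            rw [inv_smul_eq_iff, hb]; simp⟩⟩
      | one => exact ⟨fun i => ⟨i, one_smul _ _⟩, fun i => ⟨i, by simp⟩⟩
      | mul c d _ _ hc hd =>
        constructor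
        · intro i
          obtain ⟨j, hj⟩ := hd.1 i
          obtain ⟨k, hk⟩ := hc.1 j
          exact ⟨k, by rw [mul_smul, hj, hk]⟩
        · intro i
          obtain ⟨j, hj⟩ := hc.2 i
          obtain ⟨k, hk⟩ := hd.2 j
          exact ⟨k, by rw [mul_inv_rev, mul_smul, hj, hk]⟩
      | inv c _ hc => exact ⟨hc.2, by simpa using hc.1⟩
    exact (hinv r hr).1
  choose φ hφ using hex
  let ψ : R →* Function.End (Fin D.degree) :=
    { toFun := φ
      map_one' := by
        funext i
        apply hf
        rw [← hφ, one_smul]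
        rfl
      map_mul' := fun r s => by
        funext i
        apply hf
        rw [← hφ, mul_smul, hφ s, hφ r]
        rfl }
  let Φ : R →* Equiv.Perm (Fin D.degree) := MonoidHom.toHomPerm ψ
  have hΦ : ∀ r i, f (Φ r i) = r • f i := fun r i => (hφ r i).symm
  have hΦa : Φ a = D.x := Equiv.ext fun i => hf (by rw [hΦ, ha])
  have hΦb : Φ b = D.y := Equiv.ext fun i => hf (by rw [hΦ, hb])
  have hrange : Φ.range = D.monodromyGroup := by
    rw [MonoidHom.range_eq_map, ← hab, MonoidHom.map_closure, monodromyGroup_eq,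
      Set.image_pair, hΦa, hΦb]
  have hkerΦ : Φ.ker = Subgroup.center R := by
    ext r
    rw [← hker r, MonoidHom.mem_ker, Equiv.ext_iff]
    exact forall_congr' fun i => by rw [← hΦ, hf.eq_iff]; rfl
  exact ⟨(MulEquiv.subgroupCongr hrange).symm.trans
    ((QuotientGroup.quotientKerEquivRange Φ).symm.trans
      (QuotientGroup.quotientMulEquivOfEq hkerΦ))⟩

/-- If `x` and `y` act on the edges as generators of `SL_n(K)` on the points of projective space,
then the monodromy group is `PSL_n(K)`. -/
theorem hasMonodromyPSL_of_vectors {n : ℕ} {K : Type} [Field K] (D : Dessin)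
    (v : Fin D.degree → Fin n → K) {A B : Matrix.SpecialLinearGroup (Fin n) K}
    (hAB : Subgroup.closure {A, B} = ⊤) (hv : ∀ i, v i ≠ 0)
    (hinj : ∀ i j, (∃ c : K, c • v j = v i) → i = j)
    (hsurj : ∀ w, w ≠ 0 → ∃ i, ∃ c : K, c • v i = w)
    (hA : ∀ i, ∃ c : K, c • v (D.x i) = A.1.mulVec (v i))
    (hB : ∀ i, ∃ c : K, c • v (D.y i) = B.1.mulVec (v i)) : D.HasMonodromyPSL n K := by
  refine D.nonempty_monodromyGroup_equiv_quotient_center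
    (fun i => Projectivization.mk K (v i) (hv i)) (fun i j hij => hinj i j ?_) hAB
    (fun i => Projectivization.smul_mk_eq_mk _ _ (hA i))
    (fun i => Projectivization.smul_mk_eq_mk _ _ (hB i)) (fun r => ?_)
  · rwa [Projectivization.mk_eq_mk_iff'] at hij
  -- The centre is the kernel of the action on all of projective space, and by `hsurj` the edges
  -- exhaust its points.
  · rw [← Projectivization.SL_mulAction_ker, MonoidHom.mem_ker, Equiv.ext_iff]
    constructor
    · intro h p
      induction p using Projectivization.ind with
      | _ w hw =>
        obtain ⟨i, c, hc⟩ := hsurj w hw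
        have : Projectivization.mk K w hw = Projectivization.mk K (v i) (hv i) :=
          (Projectivization.mk_eq_mk_iff' ..).2 ⟨c, hc⟩
        rw [this]
        exact h i
    · exact fun h i => h (Projectivization.mk K (v i) (hv i))

theorem closure_eq_top_zmod {p : ℕ} [Fact p.Prime]
    {A B : Matrix.SpecialLinearGroup (Fin 2) (ZMod p)} (W : Fin 2 → Fin 2 → List ℕ)
    (h : ∀ i j, i ≠ j → (wordValue A B (W i j)).1 = Matrix.transvection i j 1) :
    Subgroup.closure {A, B} = ⊤ := by
  refine Matrix.SpecialLinearGroup.eq_top_of_transvection_mem_two (B := {1}) ?_ ?_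
  · rw [eq_top_iff]
    rintro a -
    rw [← AddSubgroup.zmultiples_eq_closure, AddSubgroup.mem_zmultiples_iff]
    exact ⟨a.cast, by simp⟩
  · rintro i j hij _ rfl
    have : Matrix.SpecialLinearGroup.transvection hij 1 = wordValue A B (W i j) :=
      Subtype.ext (h i j hij).symm
    rw [this]
    exact wordValue_mem (Subgroup.subset_closure (by simp)) (Subgroup.subset_closure (by simp)) _

theorem closure_eq_top_zmod_two {n : ℕ} [Nontrivial (Fin n)]
    {A B : Matrix.SpecialLinearGroup (Fin n) (ZMod 2)} (W : Fin n → Fin n → List ℕ)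
    (h : ∀ i j, i ≠ j → (wordValue A B (W i j)).1 = Matrix.transvection i j 1) :
    Subgroup.closure {A, B} = ⊤ := by
  refine Matrix.SpecialLinearGroup.eq_top_of_transvection_mem_zmod_two fun i j hij => ?_
  have : Matrix.SpecialLinearGroup.transvection hij 1 = wordValue A B (W i j) :=
    Subtype.ext (h i j hij).symm
  rw [this]
  exact wordValue_mem (Subgroup.subset_closure (by simp)) (Subgroup.subset_closure (by simp)) _

instance fact_prime_thirteen : Fact (Nat.Prime 13) := ⟨by norm_num⟩

instance fact_prime_seven : Fact (Nat.Prime 7) := ⟨by norm_num⟩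

/-- Homogeneous coordinates for the points of the projective line over `ZMod p`. -/
def lineCoordinates (p : ℕ) (i : ℕ) : Fin 2 → ZMod p := if i = p then ![1, 0] else ![i, 1]

theorem exists_smul_lineCoordinates (p : ℕ) [Fact p.Prime] (w : Fin 2 → ZMod p) :
    ∃ (i : Fin (p + 1)) (c : ZMod p), c • lineCoordinates p i = w := by
  have hp : p ≠ 0 := (Fact.out : p.Prime).ne_zero
  have : NeZero p := ⟨hp⟩
  by_cases h : w 1 = 0
  · refine ⟨Fin.last p, w 0, ?_⟩
    ext k
    fin_cases k <;> simp [lineCoordinates, h]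
  · have hlt := ZMod.val_lt (w 0 / w 1)
    refine ⟨⟨(w 0 / w 1).val, hlt.trans (Nat.lt_succ_self p)⟩, w 1, ?_⟩
    ext k
    fin_cases k <;> simp [lineCoordinates, hlt.ne, mul_div_cancel₀, h]

/-- `A` and `B` lift `x` and `y` to matrices of determinant 1. The off-diagonal words evaluate to
the two transvections with coefficient 1; the empty diagonal words are placeholders. -/
theorem hasMonodromyPSL_mapTwoFaces_zero : (mapTwoFaces 0).HasMonodromyPSL 2 (ZMod 13) := by
  let A : Matrix.SpecialLinearGroup (Fin 2) (ZMod 13) :=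
    ⟨!![1, 2; 5, 11], by rw [Matrix.det_fin_two_of]; decide⟩
  let B : Matrix.SpecialLinearGroup (Fin 2) (ZMod 13) :=
    ⟨!![0, 12; 1, 0], by rw [Matrix.det_fin_two_of]; decide⟩
  refine hasMonodromyPSL_of_vectors _ (fun i => lineCoordinates 13 i) (A := A) (B := B)
    (closure_eq_top_zmod ![![[], [1, 0, 1, 0, 0, 1, 0, 1, 0, 0, 1, 0, 0, 1, 0]],
      ![[1, 0, 0, 1, 0, 1, 0, 1, 0, 0, 1, 0, 1, 0, 0], []]] (by decide +kernel))
    (by decide +kernel) (by decide +kernel) (fun w _ => exists_smul_lineCoordinates 13 w)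
    (by decide +kernel)
    (by decide +kernel)

theorem hasMonodromyPSL_mapTwoFaces_one : (mapTwoFaces 1).HasMonodromyPSL 2 (ZMod 13) := by
  let A : Matrix.SpecialLinearGroup (Fin 2) (ZMod 13) :=
    ⟨!![2, 1; 6, 10], by rw [Matrix.det_fin_two_of]; decide⟩
  let B : Matrix.SpecialLinearGroup (Fin 2) (ZMod 13) :=
    ⟨!![0, 12; 1, 0], by rw [Matrix.det_fin_two_of]; decide⟩
  refine hasMonodromyPSL_of_vectors _ (fun i => lineCoordinates 13 i) (A := A) (B := B)
    -- `B` squares to -1, so the leading letters 1, 1 only correct a sign.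
    (closure_eq_top_zmod ![![[], [1, 1, 0, 0, 1, 0, 1, 0, 1]],
      ![[0, 0, 1, 0, 0, 1, 0, 1], []]] (by decide +kernel))
    (by decide +kernel) (by decide +kernel) (fun w _ => exists_smul_lineCoordinates 13 w)
    (by decide +kernel)
    (by decide +kernel)

theorem hasMonodromyPSL_mapTwoFaces_two : (mapTwoFaces 2).HasMonodromyPSL 2 (ZMod 13) := by
  let A : Matrix.SpecialLinearGroup (Fin 2) (ZMod 13) :=
    ⟨!![3, 0; 6, 9], by rw [Matrix.det_fin_two_of]; decide⟩
  let B : Matrix.SpecialLinearGroup (Fin 2) (ZMod 13) :=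
    ⟨!![0, 12; 1, 0], by rw [Matrix.det_fin_two_of]; decide⟩
  refine hasMonodromyPSL_of_vectors _ (fun i => lineCoordinates 13 i) (A := A) (B := B)
    (closure_eq_top_zmod ![![[], [1, 1, 1, 0, 0, 1, 0, 1, 0, 0, 1, 0, 1, 0, 1, 0, 0]],
      ![[1, 0, 0, 1, 0, 1, 0, 1, 0, 1, 0, 0, 1, 0, 0, 1, 0], []]] (by decide +kernel))
    (by decide +kernel) (by decide +kernel) (fun w _ => exists_smul_lineCoordinates 13 w)
    (by decide +kernel)
    (by decide +kernel)

theorem hasMonodromyPSL_mapOneFace_two : (mapOneFace 2).HasMonodromyPSL 2 (ZMod 7) := by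
  let A : Matrix.SpecialLinearGroup (Fin 2) (ZMod 7) :=
    ⟨!![0, 1; 6, 6], by rw [Matrix.det_fin_two_of]; decide⟩
  let B : Matrix.SpecialLinearGroup (Fin 2) (ZMod 7) :=
    ⟨!![0, 6; 1, 0], by rw [Matrix.det_fin_two_of]; decide⟩
  refine hasMonodromyPSL_of_vectors _ (fun i => lineCoordinates 7 i) (A := A) (B := B)
    (closure_eq_top_zmod ![![[], [1, 0]], ![[1, 1, 1, 0, 0], []]] (by decide +kernel))
    (by decide +kernel) (by decide +kernel) (fun w _ => exists_smul_lineCoordinates 7 w)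
    (by decide +kernel)
    (by decide +kernel)

/-- The vector over `ZMod 2` whose coordinates are the last binary digits of `i`. -/
def binaryVector (i : ℕ) : Fin 3 → ZMod 2 := fun k => ((i / 2 ^ (k : ℕ) : ℕ) : ZMod 2)

/-- The images of `x` and `y` under an isomorphism from the monodromy group to `SL_3(2)`. -/
def generatorsSLThreeZero : Fin 2 → Matrix.SpecialLinearGroup (Fin 3) (ZMod 2) :=
  ![⟨!![0, 1, 0; 0, 0, 1; 1, 0, 0], by rw [Matrix.det_fin_three]; decide⟩,
    ⟨!![1, 0, 0; 0, 1, 0; 0, 1, 1], by rw [Matrix.det_fin_three]; decide⟩]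

theorem closure_generatorsSLThreeZero :
    Subgroup.closure {generatorsSLThreeZero 0, generatorsSLThreeZero 1} = ⊤ :=
  closure_eq_top_zmod_two ![![[], [1, 0, 0, 1, 0, 1, 0, 0, 1, 0], [0, 0, 1, 0]],
    ![[0, 1, 0, 0], [], [0, 1, 0, 1, 0, 0, 1, 0, 1, 0]],
    ![[1, 0, 1, 0, 0, 1, 0, 1, 0, 0], [1], []]] (by decide +kernel)

theorem hasMonodromyPSL_mapOneFace_zero : (mapOneFace 0).HasMonodromyPSL 3 (ZMod 2) :=
  hasMonodromyPSL_of_vectors _ (fun i => binaryVector (i + 1)) closure_generatorsSLThreeZero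
    (by decide +kernel) (by decide +kernel) (by decide +kernel) (by decide +kernel)
    (by decide +kernel)

/-- The images of `x` and `y` under an isomorphism from the monodromy group to `SL_3(2)`. -/
def generatorsSLThreeOne : Fin 2 → Matrix.SpecialLinearGroup (Fin 3) (ZMod 2) :=
  ![⟨!![0, 0, 1; 1, 0, 0; 0, 1, 0], by rw [Matrix.det_fin_three]; decide⟩,
    ⟨!![1, 0, 0; 0, 1, 0; 0, 1, 1], by rw [Matrix.det_fin_three]; decide⟩]

theorem closure_generatorsSLThreeOne :
    Subgroup.closure {generatorsSLThreeOne 0, generatorsSLThreeOne 1} = ⊤ :=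
  closure_eq_top_zmod_two ![![[], [1, 0, 1, 0, 0, 1, 0, 1, 0, 0], [0, 1, 0, 0]],
    ![[0, 0, 1, 0], [], [0, 1, 0, 1, 0, 0, 1, 0, 1, 0]],
    ![[1, 0, 0, 1, 0, 1, 0, 0, 1, 0], [1], []]] (by decide +kernel)

theorem hasMonodromyPSL_mapOneFace_one : (mapOneFace 1).HasMonodromyPSL 3 (ZMod 2) :=
  hasMonodromyPSL_of_vectors _ (fun i => binaryVector (i + 1)) closure_generatorsSLThreeOne
    (by decide +kernel) (by decide +kernel) (by decide +kernel) (by decide +kernel)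
    (by decide +kernel)

end Dessin

/-! ### A computable field of eight elements, and PSL₂(8) -/

/-- The field with eight elements: the polynomials over `ZMod 2` of degree less than three, encoded
in binary, modulo `X³ + X + 1`. -/
def FieldEight : Type := Fin 8

namespace FieldEight

instance : DecidableEq FieldEight := inferInstanceAs (DecidableEq (Fin 8))

instance : Fintype FieldEight := inferInstanceAs (Fintype (Fin 8))

/-- The polynomial with the binary code `i`. -/
def ofFin (i : Fin 8) : FieldEight := i

/-- The exponents of the nonzero elements as powers of `X`. -/
def log : FieldEight → ℕ := (![0, 0, 1, 3, 2, 6, 4, 5] : Fin 8 → ℕ)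

/-- The powers of `X`. -/
def pow (n : ℕ) : FieldEight :=
  (![1, 2, 4, 3, 6, 7, 5] : Fin 7 → Fin 8) ⟨n % 7, Nat.mod_lt _ (by norm_num)⟩

/-- Adding polynomials over `ZMod 2` is exclusive or of their codes; so each element is its own
negative. -/
instance : Add FieldEight := ⟨fun a b => (Fin.xor a b : Fin 8)⟩

/-- Nonzero elements multiply by adding exponents of X modulo 7; the dummy value of `log` at 0 is
never used. -/
instance : Mul FieldEight :=
  ⟨fun a b => if a = ofFin 0 ∨ b = ofFin 0 then ofFin 0 else pow (log a + log b)⟩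

instance : Zero FieldEight := ⟨ofFin 0⟩

instance : One FieldEight := ⟨ofFin 1⟩

instance : Neg FieldEight := ⟨id⟩

instance : Inv FieldEight := ⟨fun a => if a = ofFin 0 then ofFin 0 else pow (7 - log a)⟩

instance : CommRing FieldEight where
  add_assoc := by decide +kernel
  zero_add := by decide +kernel
  add_zero := by decide +kernel
  add_comm := by decide +kernel
  left_distrib := by decide +kernel
  right_distrib := by decide +kernel
  zero_mul := by decide +kernel
  mul_zero := by decide +kernel
  mul_assoc := by decide +kernel
  one_mul := by decide +kernel
  mul_one := by decide +kernel
  neg_add_cancel := by decide +kernel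
  mul_comm := by decide +kernel
  nsmul := nsmulRec
  zsmul := zsmulRec

instance : Field FieldEight where
  exists_pair_ne := ⟨0, 1, by decide⟩
  mul_inv_cancel := by decide +kernel
  inv_zero := by decide +kernel
  nnqsmul := _
  nnqsmul_def := fun _ _ => rfl
  qsmul := _
  qsmul_def := fun _ _ => rfl

/-- Finite fields of equal size are isomorphic; this carries the identities evaluated in the
explicit model over to `GaloisField 2 3`. -/
theorem nonempty_ringEquiv_galoisField : Nonempty (FieldEight ≃+* GaloisField 2 3) := by
  have : Fintype (GaloisField 2 3) := Fintype.ofFinite _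
  refine ⟨FiniteField.ringEquivOfCardEq ?_⟩
  rw [← Nat.card_eq_fintype_card (α := GaloisField 2 3), GaloisField.card 2 3 (by norm_num)]
  rfl

/-- The codes 1, 2, 4 stand for the basis 1, X, X² over `ZMod 2`. -/
theorem addSubgroup_closure_eq_top :
    AddSubgroup.closure (Set.range ![ofFin 1, ofFin 2, ofFin 4]) = ⊤ := by
  rw [eq_top_iff]
  rintro a -
  have h : ∀ i : Fin 3, ![ofFin 1, ofFin 2, ofFin 4] i ∈
      AddSubgroup.closure (Set.range ![ofFin 1, ofFin 2, ofFin 4]) :=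
    fun i => AddSubgroup.subset_closure ⟨i, rfl⟩
  obtain ⟨p, q, r, rfl⟩ : ∃ p q r : Fin 2, (p : ℕ) • ofFin 1 + (q : ℕ) • ofFin 2 +
      (r : ℕ) • ofFin 4 = a := by
    revert a
    decide +kernel
  exact add_mem (add_mem (AddSubgroup.nsmul_mem _ (h 0) _) (AddSubgroup.nsmul_mem _ (h 1) _))
    (AddSubgroup.nsmul_mem _ (h 2) _)

end FieldEight

namespace Dessin

theorem hasMonodromyPSL_mapOneFace_three_fieldEight :
    (mapOneFace 3).HasMonodromyPSL 2 FieldEight := by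
  let A : Matrix.SpecialLinearGroup (Fin 2) FieldEight :=
    ⟨(!![0, 3; 6, 1] : Matrix (Fin 2) (Fin 2) (Fin 8)).map FieldEight.ofFin, by
      rw [Matrix.det_fin_two]; decide +kernel⟩
  let B : Matrix.SpecialLinearGroup (Fin 2) FieldEight :=
    ⟨(!![0, 1; 1, 0] : Matrix (Fin 2) (Fin 2) (Fin 8)).map FieldEight.ofFin, by
      rw [Matrix.det_fin_two]; decide +kernel⟩
  -- `W i j k` spells the transvection in position (i, j) with coefficient X^k.
  let W : Fin 2 → Fin 2 → Fin 3 → List ℕ :=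
    ![![![[], [], []],
      ![[0, 0, 1, 0, 1, 0, 0, 1, 0, 1, 0, 0, 1, 0], [0, 1, 0, 0, 1, 0, 1, 0, 0],
        [1, 0, 0, 1, 0, 0, 1, 0, 1, 0, 1]]],
    ![![[1, 0, 0, 1, 0, 1, 0, 0, 1, 0, 1, 0, 0, 1, 0, 1], [1, 0, 1, 0, 0, 1, 0, 1, 0, 0, 1],
      [0, 0, 1, 0, 0, 1, 0, 1, 0]], ![[], [], []]]]
  have hW : ∀ i j, i ≠ j → ∀ k, (wordValue A B (W i j k)).1 = Matrix.transvection i j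
      (![FieldEight.ofFin 1, FieldEight.ofFin 2, FieldEight.ofFin 4] k) := by decide +kernel
  refine hasMonodromyPSL_of_vectors _
    (fun i : Fin 9 => if h : (i : ℕ) < 8 then ![FieldEight.ofFin ⟨i, h⟩, 1] else ![1, 0])
    (A := A) (B := B)
    (Matrix.SpecialLinearGroup.eq_top_of_transvection_mem_two
      FieldEight.addSubgroup_closure_eq_top ?_)
    (by decide +kernel) (by decide +kernel) (by decide +kernel) (by decide +kernel)
    (by decide +kernel)
  rintro i j hij _ ⟨k, rfl⟩
  rw [show Matrix.SpecialLinearGroup.transvection hij _ = wordValue A B (W i j k) from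
    Subtype.ext (hW i j hij k).symm]
  exact wordValue_mem (Subgroup.subset_closure (by simp)) (Subgroup.subset_closure (by simp)) _

theorem hasMonodromyPSL_mapOneFace_three :
    (mapOneFace 3).HasMonodromyPSL 2 (GaloisField 2 3) := by
  obtain ⟨e⟩ := hasMonodromyPSL_mapOneFace_three_fieldEight
  obtain ⟨f⟩ := FieldEight.nonempty_ringEquiv_galoisField
  exact ⟨e.trans (QuotientGroup.congr _ _ (Matrix.SpecialLinearGroup.mapEquiv f)
    (MulEquiv.map_center_eq _))⟩

/-! ### PSL₃(2) on the oriented lines of the Fano plane -/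

/-- Binary codes of the points of the lines of the Fano plane. -/
def fanoLine : Fin 7 → Fin 3 → ℕ :=
  ![![1, 2, 3], ![1, 4, 5], ![1, 6, 7], ![2, 4, 6], ![2, 5, 7], ![3, 4, 7], ![3, 5, 6]]

/-- The lines of the Fano plane with the two cyclic orders of their points, as sets of pairs of
consecutive points. -/
def orientedLine (i : Fin 14) : Finset ((Fin 3 → ZMod 2) × (Fin 3 → ZMod 2)) :=
  if h : (i : ℕ) < 7 then
    Finset.univ.image fun k => (binaryVector (fanoLine ⟨i, h⟩ k),
      binaryVector (fanoLine ⟨i, h⟩ (k + 1)))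
  else Finset.univ.image fun k => (binaryVector (fanoLine ⟨i - 7, by omega⟩ (k + 1)),
      binaryVector (fanoLine ⟨i - 7, by omega⟩ k))

theorem orientedLine_injective : Function.Injective orientedLine := by
  have : ∀ i j, orientedLine i = orientedLine j → i = j := by decide +kernel
  exact fun i j => this i j

open scoped Pointwise

/-- A matrix that preserves every oriented line preserves every line; lines separate points, so it
fixes all vectors. The centre is trivial too, as the only cube root of 1 in `ZMod 2` is 1. -/
theorem smul_orientedLine_iff (r : Matrix.SpecialLinearGroup (Fin 3) (ZMod 2)) :
    (∀ i, r • orientedLine i = orientedLine i) ↔ r ∈ Subgroup.center _ := by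
  constructor
  · intro h
    have hsep : ∀ v w : Fin 3 → ZMod 2, v ≠ 0 → w ≠ 0 → v ≠ w →
        ∃ i, v ∈ (orientedLine i).image Prod.fst ∧ w ∉ (orientedLine i).image Prod.fst := by
      decide +kernel
    have hfix : ∀ v : Fin 3 → ZMod 2, r • v = v := by
      intro v
      by_cases hv : v = 0
      · rw [hv, smul_zero]
      by_contra hne
      obtain ⟨i, hb, hw⟩ := hsep v (r • v) hv ((smul_ne_zero_iff_ne r).2 hv) (Ne.symm hne)
      obtain ⟨⟨_, b⟩, hb', rfl⟩ := Finset.mem_image.1 hb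
      refine hw (Finset.mem_image.2 ⟨r • (_, b), ?_, rfl⟩)
      have := Finset.smul_mem_smul_finset (a := r) hb'
      rwa [h i] at this
    have hr : r = 1 := by
      apply Subtype.ext
      apply Matrix.mulVec_injective
      funext v
      rw [Matrix.SpecialLinearGroup.coe_one, Matrix.one_mulVec]
      exact hfix v
    rw [hr]
    exact one_mem _
  · intro h i
    obtain ⟨c, hc, hr⟩ := Matrix.SpecialLinearGroup.mem_center_iff.1 h
    have hc' : ∀ c : ZMod 2, c ^ Fintype.card (Fin 3) = 1 → c = 1 := by decide
    have : r = 1 := Subtype.ext (by rw [← hr, hc' c hc, map_one]; rfl)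
    rw [this, one_smul]

/-- The generators are those of the first tree of degree 7, now acting on oriented lines instead of
points. -/
theorem hasMonodromyPSL_mapTwoFaces_seven : (mapTwoFaces 7).HasMonodromyPSL 3 (ZMod 2) :=
  (mapTwoFaces 7).nonempty_monodromyGroup_equiv_quotient_center orientedLine orientedLine_injective
    closure_generatorsSLThreeZero (by decide +kernel) (by decide +kernel) smul_orientedLine_iff

theorem hasMonodromyPSL_mapTwoFaces_eight : (mapTwoFaces 8).HasMonodromyPSL 3 (ZMod 2) :=
  (mapTwoFaces 8).nonempty_monodromyGroup_equiv_quotient_center orientedLine orientedLine_injective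
    closure_generatorsSLThreeOne (by decide +kernel) (by decide +kernel) smul_orientedLine_iff

/-! ### Primitivity, block systems and alternating groups -/

/-- Two words in the stabiliser of `a` already move `b` to every other edge, which gives
2-transitivity. -/
theorem isPreprimitive_of_words (D : Dessin) (a b : Fin D.degree) (v w : List ℕ) (k : ℕ)
    (hv : wordValue D.x D.y v a = a) (hw : wordValue D.x D.y w a = a)
    (h : ∀ c, c ≠ a → c ∈ (orbitStep (⇑(wordValue D.x D.y v))
      (⇑(wordValue D.x D.y w)))^[k] {b}) :
    MulAction.IsPreprimitive D.monodromyGroup (Fin D.degree) := by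
  refine isPreprimitive_of_two_transitive a b (fun c => ?_) fun c hc => ?_
  · obtain ⟨g, hg⟩ := D.transitive.exists_smul_eq a c
    exact ⟨g, g.2, hg⟩
  · have hmem : ∀ w, wordValue D.x D.y w ∈ D.monodromyGroup :=
      wordValue_mem D.x_mem_monodromyGroup D.y_mem_monodromyGroup
    obtain ⟨g, hg, rfl⟩ := exists_of_mem_orbitStep_iterate
      (H := D.monodromyGroup ⊓ MulAction.stabilizer (Equiv.Perm (Fin D.degree)) a)
      ⟨hmem v, hv⟩ ⟨hmem w, hw⟩ b k c (h c hc)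
    exact ⟨g, hg.1, hg.2, rfl⟩

/-- `x` and `z` have odd order, hence are even, and `y` is even because of the relation. -/
theorem HasType.monodromyGroup_le_alternatingGroup {D : Dessin} (h : D.HasType 3 2 7) :
    D.monodromyGroup ≤ alternatingGroup (Fin D.degree) := by
  have hodd : ∀ s : ℤˣ, (s ^ 3 = 1 → s = 1) ∧ (s ^ 7 = 1 → s = 1) := by decide
  have hx : Equiv.Perm.sign D.x = 1 := (hodd _).1 (by
    rw [← map_pow, ← h.1, pow_orderOf_eq_one, map_one])
  have hz : Equiv.Perm.sign D.z = 1 := (hodd _).2 (by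
    rw [← map_pow, ← h.2.2, pow_orderOf_eq_one, map_one])
  have hy : Equiv.Perm.sign D.y = 1 := by
    have := congrArg Equiv.Perm.sign D.xyz_eq_one
    simpa [hx, hz] using this
  rw [monodromyGroup, Subgroup.closure_le]
  rintro a (rfl | rfl | rfl) <;> exact Equiv.Perm.mem_alternatingGroup.2 ‹_›

/-- Jordan's theorem: a primitive group with a 3-cycle contains the alternating group. The power `k`
kills all but one 3-cycle of the word. -/
theorem HasType.monodromyGroup_eq_alternatingGroup {D : Dessin} (h : D.HasType 3 2 7)
    (hp : MulAction.IsPreprimitive D.monodromyGroup (Fin D.degree)) (w : List ℕ) (k : ℕ)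
    (hw : (wordValue D.x D.y w ^ k).support.card = 3) :
    D.monodromyGroup = alternatingGroup (Fin D.degree) :=
  le_antisymm h.monodromyGroup_le_alternatingGroup
    (Equiv.Perm.alternatingGroup_le_of_isPreprimitive_of_isThreeCycle_mem hp
      (card_support_eq_three_iff.1 hw)
      (pow_mem (wordValue_mem D.x_mem_monodromyGroup D.y_mem_monodromyGroup w) k))

/-- Each word is the translation t ↦ t + 1, which fixes infinity (13) and permutes the other points
cyclically. -/
theorem not_isImprimitive_mapTwoFaces (i : Fin 12) (hi : (i : ℕ) < 3) :
    ¬ (mapTwoFaces i).IsImprimitive := by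
  rw [IsImprimitive, not_not]
  match i, hi with
  | 0, _ =>
    exact isPreprimitive_of_words _ ⟨13, by decide +kernel⟩ ⟨0, by decide +kernel⟩
      [1, 0, 1, 0, 0, 1, 0, 1, 0, 0, 1, 0, 0, 1, 0] [] 13
      (by decide +kernel) (by decide +kernel)
      (by decide +kernel)
  | 1, _ =>
    exact isPreprimitive_of_words _ ⟨13, by decide +kernel⟩ ⟨0, by decide +kernel⟩
      [1, 1, 0, 0, 1, 0, 1, 0, 1] [] 13
      (by decide +kernel) (by decide +kernel)
      (by decide +kernel)
  | 2, _ =>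
    exact isPreprimitive_of_words _ ⟨13, by decide +kernel⟩ ⟨0, by decide +kernel⟩
      [1, 1, 1, 0, 0, 1, 0, 1, 0, 0, 1, 0, 1, 0, 1, 0, 0] [] 13
      (by decide +kernel) (by decide +kernel)
      (by decide +kernel)

/-- The blocks are the pairs {i, i + 7}: opposite units, or the two orientations of a line. -/
theorem isImprimitive_mapTwoFaces (i : Fin 12) (hi : 3 ≤ (i : ℕ)) (hi' : (i : ℕ) < 9) :
    (mapTwoFaces i).IsImprimitive := by
  have hx : ∀ i : Fin 12, 3 ≤ (i : ℕ) → (i : ℕ) < 9 → ∀ j k : Fin (mapTwoFaces i).degree,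
      (j : ℕ) % 7 = k % 7 → ((mapTwoFaces i).x j : ℕ) % 7 = (mapTwoFaces i).x k % 7 := by
    decide +kernel
  have hy : ∀ i : Fin 12, 3 ≤ (i : ℕ) → (i : ℕ) < 9 → ∀ j k : Fin (mapTwoFaces i).degree,
      (j : ℕ) % 7 = k % 7 → ((mapTwoFaces i).y j : ℕ) % 7 = (mapTwoFaces i).y k % 7 := by
    decide +kernel
  have hc : ∀ i : Fin 12, 3 ≤ (i : ℕ) → (i : ℕ) < 9 → ∃ a b c : Fin (mapTwoFaces i).degree,
      a ≠ b ∧ (a : ℕ) % 7 = b % 7 ∧ (a : ℕ) % 7 ≠ c % 7 := by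
    decide +kernel
  obtain ⟨a, b, c, hab, hfab, hac⟩ := hc i hi hi'
  refine not_isPreprimitive_of_invariant (fun j => (j : ℕ) % 7) (fun g hg => ?_) hab hfab hac
  rw [monodromyGroup_eq] at hg
  induction hg using Subgroup.closure_induction with
  | mem a ha =>
    rcases ha with rfl | rfl
    · exact hx i hi hi'
    · exact hy i hi hi'
  | one => exact fun _ _ h => h
  | mul a b _ _ ha hb => exact fun j k h => ha _ _ (hb _ _ h)
  | inv a _ ha =>
    -- The congruence is a subset of the finite set of pairs, preserved by `a` acting on both
    -- entries, hence also by the inverse.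
    exact fun j k h => Equiv.Perm.inv_mem_of_forall_mem (a.prodCongr a)
      (S := {p | (p.1 : ℕ) % 7 = p.2 % 7}) (fun p hp => ha _ _ hp) (i := (j, k)) h

theorem nonempty_monodromyGroup_mapTwoFaces_nine_equiv :
    Nonempty ((mapTwoFaces 9).monodromyGroup ≃* alternatingGroup (Fin 15)) :=
  ⟨MulEquiv.subgroupCongr ((isMap327_mapTwoFaces 9).1.monodromyGroup_eq_alternatingGroup
    (isPreprimitive_of_words _ ⟨0, by decide +kernel⟩ ⟨1, by decide +kernel⟩ [1, 0, 1, 0, 0, 1]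
      [0, 1, 0, 1, 0, 1, 0, 0] 10 (by decide +kernel) (by decide +kernel) (by decide +kernel))
    [1, 0, 1, 0, 0] 35 (by decide +kernel))⟩

theorem nonempty_monodromyGroup_mapTwoFaces_ten_equiv :
    Nonempty ((mapTwoFaces 10).monodromyGroup ≃* alternatingGroup (Fin 15)) :=
  ⟨MulEquiv.subgroupCongr ((isMap327_mapTwoFaces 10).1.monodromyGroup_eq_alternatingGroup
    (isPreprimitive_of_words _ ⟨0, by decide +kernel⟩ ⟨1, by decide +kernel⟩ [1, 0, 1, 0, 0, 1]
      [0, 0, 1, 0, 1, 0, 1] 10 (by decide +kernel) (by decide +kernel) (by decide +kernel))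
    [1, 0, 1, 0, 0] 11 (by decide +kernel))⟩

theorem nonempty_monodromyGroup_mapTwoFaces_eleven_equiv :
    Nonempty ((mapTwoFaces 11).monodromyGroup ≃* alternatingGroup (Fin 15)) :=
  ⟨MulEquiv.subgroupCongr ((isMap327_mapTwoFaces 11).1.monodromyGroup_eq_alternatingGroup
    (isPreprimitive_of_words _ ⟨0, by decide +kernel⟩ ⟨1, by decide +kernel⟩ [1, 0, 1, 0, 0, 1]
      [0, 1, 0, 0, 1, 0, 1] 10 (by decide +kernel) (by decide +kernel) (by decide +kernel))
    [1, 0, 1, 0, 0] 11 (by decide +kernel))⟩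

end Dessin

/-! ### Octonion units and the groups of order 1344 -/

/-- Products of imaginary units of the octonions: `i` and `i + 7` stand for opposite units. Products
of a unit with itself and its opposite, which are not imaginary, are replaced by the unit. -/
def octonionMul : Fin 14 → Fin 14 → Fin 14 :=
  ![![0, 3, 6, 8, 5, 11, 9, 0, 10, 13, 1, 12, 4, 2],
    ![10, 1, 4, 0, 9, 6, 12, 3, 1, 11, 7, 2, 13, 5],
    ![13, 11, 2, 5, 1, 10, 0, 6, 4, 2, 12, 8, 3, 7],
    ![1, 7, 12, 3, 6, 2, 11, 8, 0, 5, 3, 13, 9, 4],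
    ![12, 2, 8, 13, 4, 0, 3, 5, 9, 1, 6, 4, 7, 10],
    ![4, 13, 3, 9, 7, 5, 1, 11, 6, 10, 2, 0, 5, 8],
    ![2, 5, 7, 4, 10, 8, 6, 9, 12, 0, 11, 3, 1, 6],
    ![7, 10, 13, 1, 12, 4, 2, 7, 3, 6, 8, 5, 11, 9],
    ![3, 8, 11, 7, 2, 13, 5, 10, 8, 4, 0, 9, 6, 12],
    ![6, 4, 9, 12, 8, 3, 7, 13, 11, 9, 5, 1, 10, 0],
    ![8, 0, 5, 10, 13, 9, 4, 1, 7, 12, 10, 6, 2, 11],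
    ![5, 9, 1, 6, 11, 7, 10, 12, 2, 8, 13, 11, 0, 3],
    ![11, 6, 10, 2, 0, 12, 8, 4, 13, 3, 9, 7, 12, 1],
    ![9, 12, 0, 11, 3, 1, 13, 2, 5, 7, 4, 10, 8, 13]]

/-- The opposite of an imaginary unit of the octonions. -/
def octonionNeg (a : Fin 14) : Fin 14 := a + 7

/-- The triples of units that do not lie in a quaternion subalgebra. -/
def octonionTriples : Finset (Fin 14 × Fin 14 × Fin 14) :=
  Finset.univ.filter fun t => t.2.1 ≠ t.1 ∧ t.2.1 ≠ octonionNeg t.1 ∧ t.2.2 ≠ t.1 ∧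
    t.2.2 ≠ octonionNeg t.1 ∧ t.2.2 ≠ t.2.1 ∧ t.2.2 ≠ octonionNeg t.2.1 ∧
    t.2.2 ≠ octonionMul t.1 t.2.1 ∧ t.2.2 ≠ octonionNeg (octonionMul t.1 t.2.1)

/-- 14 · 12 · 8: each choice excludes the units generated so far, up to sign. -/
theorem card_octonionTriples : octonionTriples.card = 1344 := by decide +kernel

/-- The group of permutations of the units that respect products and opposites. -/
def octonionAut : Subgroup (Equiv.Perm (Fin 14)) where
  carrier := {g | (∀ a b, g (octonionMul a b) = octonionMul (g a) (g b)) ∧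
    ∀ a, g (octonionNeg a) = octonionNeg (g a)}
  one_mem' := ⟨fun _ _ => rfl, fun _ => rfl⟩
  mul_mem' := fun {g h} hg hh => ⟨fun a b => by
    simp only [Equiv.Perm.mul_apply, hh.1, hg.1], fun a => by
    simp only [Equiv.Perm.mul_apply, hh.2, hg.2]⟩
  inv_mem' := fun {g} hg => ⟨fun a b => by
    rw [Equiv.Perm.inv_eq_iff_eq, hg.1]; simp, fun a => by
    rw [Equiv.Perm.inv_eq_iff_eq, hg.2]; simp⟩

/-- The units 0, 1, 2 generate all units by products and opposites. -/
theorem octonionAut_ext {g h : Equiv.Perm (Fin 14)} (hg : g ∈ octonionAut) (hh : h ∈ octonionAut)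
    (h0 : g 0 = h 0) (h1 : g 1 = h 1) (h2 : g 2 = h 2) : g = h := by
  have hgen : ∀ i, ∃ j ∈ [0, 1, 2, octonionMul 0 1, octonionMul 0 2, octonionMul 1 2,
      octonionMul (octonionMul 0 1) 2], i = j ∨ i = octonionNeg j := by decide +kernel
  have hj : ∀ j ∈ [0, 1, 2, octonionMul 0 1, octonionMul 0 2, octonionMul 1 2,
      octonionMul (octonionMul 0 1) 2], g j = h j := by
    simp [hg.1, hh.1, h0, h1, h2]
  refine Equiv.ext fun i => ?_
  obtain ⟨j, hj', rfl | rfl⟩ := hgen i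
  · exact hj _ hj'
  · rw [hg.2, hh.2, hj j hj']

/-- An automorphism is determined by the image of the triple (0, 1, 2), which is again outside every
quaternion subalgebra. -/
theorem card_octonionAut_le : Nat.card octonionAut ≤ 1344 := by
  have hbase : ((0, 1, 2) : Fin 14 × Fin 14 × Fin 14) ∈ octonionTriples := by decide +kernel
  rw [← card_octonionTriples, ← Nat.card_eq_finsetCard]
  refine Nat.card_le_card_of_injective
    (fun g : octonionAut => (⟨(g.1 0, g.1 1, g.1 2), ?_⟩ : octonionTriples)) ?_
  · simp only [octonionTriples, Finset.mem_filter_univ] at hbase ⊢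
    simpa only [← g.2.1, ← g.2.2, ne_eq, EmbeddingLike.apply_eq_iff_eq] using hbase
  · intro g h hgh
    simp only [Subtype.mk.injEq, Prod.mk.injEq] at hgh
    exact Subtype.ext (octonionAut_ext g.2 h.2 hgh.1 hgh.2.1 hgh.2.2)

/-- A subgroup is large if it is transitive on independent triples of units. -/
theorem le_card_of_orbits {H : Subgroup (Equiv.Perm (Fin 14))} (S T : Finset (Fin 14))
    (h0 : ∀ p, ∃ g ∈ H, g 0 = p) (h1 : ∀ q ∈ S, ∃ g ∈ H, g 0 = 0 ∧ g 1 = q)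
    (h2 : ∀ r ∈ T, ∃ g ∈ H, g 0 = 0 ∧ g 1 = 1 ∧ g 2 = r) :
    14 * (S.card * T.card) ≤ Nat.card H := by
  choose f hf hf0 using h0
  choose k hk hk0 hk1 using h1
  choose l hl hl0 hl1 hl2 using h2
  have hcard : Nat.card (Fin 14 × S × T) = 14 * (S.card * T.card) := by
    simp
  rw [← hcard]
  -- Products along the stabiliser chain of 0, 1 are distinct: the images of 0, 1, 2 recover the
  -- three factors in turn.
  refine Nat.card_le_card_of_injective
    (fun t : Fin 14 × S × T => (⟨f t.1 * (k t.2.1 t.2.1.2 * l t.2.2 t.2.2.2),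
      mul_mem (hf _) (mul_mem (hk _ _) (hl _ _))⟩ : H)) ?_
  rintro ⟨p, q, r⟩ ⟨p', q', r'⟩ heq
  have heq' := congrArg Subtype.val heq
  dsimp only at heq'
  obtain rfl : p = p' := by
    have := DFunLike.congr_fun heq' 0
    simpa [hk0, hl0, hf0] using this
  have heq2 := mul_left_cancel heq'
  obtain rfl : q = q' := by
    have := DFunLike.congr_fun heq2 1
    simp only [Equiv.Perm.mul_apply, hl1, hk1] at this
    exact Subtype.ext this
  have heq3 := DFunLike.congr_fun (mul_left_cancel heq2) 2
  rw [hl2, hl2] at heq3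
  rw [Subtype.ext heq3]

theorem exists_of_subset_orbitStep_iterate {α : Type*} [DecidableEq α]
    {H : Subgroup (Equiv.Perm α)} {x y : Equiv.Perm α} (hx : x ∈ H) (hy : y ∈ H) (a : α) (k : ℕ)
    (S : Finset α) (hS : S ⊆ (orbitStep x y)^[k] {a}) : ∀ b ∈ S, ∃ g ∈ H, g a = b :=
  fun b hb => exists_of_mem_orbitStep_iterate hx hy a k b (hS hb)

namespace Dessin

/-- The group preserves the octonion products, so its order is at most 1344; orbits along the
stabiliser chain show that it is at least that. -/
theorem card_eq_of_octonions {x y : Equiv.Perm (Fin 14)} (hx : x ∈ octonionAut)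
    (hy : y ∈ octonionAut) (S T : Finset (Fin 14)) (hST : 14 * (S.card * T.card) = 1344)
    (v w v' w' : List ℕ)
    (h0 : Finset.univ ⊆ (orbitStep x y)^[10] {0})
    (hv : wordValue x y v 0 = 0) (hw : wordValue x y w 0 = 0)
    (h1 : S ⊆ (orbitStep (⇑(wordValue x y v)) (⇑(wordValue x y w)))^[12] {1})
    (hv' : wordValue x y v' 0 = 0 ∧ wordValue x y v' 1 = 1)
    (hw' : wordValue x y w' 0 = 0 ∧ wordValue x y w' 1 = 1)
    (h2 : T ⊆ (orbitStep (⇑(wordValue x y v')) (⇑(wordValue x y w')))^[8] {2}) :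
    Nat.card (Subgroup.closure {x, y}) = 1344 := by
  have hx' : x ∈ Subgroup.closure {x, y} := Subgroup.subset_closure (by simp)
  have hy' : y ∈ Subgroup.closure {x, y} := Subgroup.subset_closure (by simp)
  have hmem := wordValue_mem hx' hy'
  have hstab0 : ∀ g : Equiv.Perm (Fin 14), g 0 = 0 →
      g ∈ MulAction.stabilizer (Equiv.Perm (Fin 14)) (0 : Fin 14) := fun g hg => hg
  have hstab : ∀ g : Equiv.Perm (Fin 14), g 0 = 0 ∧ g 1 = 1 →
      g ∈ MulAction.stabilizer (Equiv.Perm (Fin 14)) (0 : Fin 14) ⊓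
        MulAction.stabilizer (Equiv.Perm (Fin 14)) (1 : Fin 14) :=
    fun g hg => Subgroup.mem_inf.2 ⟨hg.1, hg.2⟩
  apply le_antisymm
  · refine le_trans (Nat.card_le_card_of_injective (Subgroup.inclusion (?_ : _ ≤ octonionAut))
      (Subgroup.inclusion_injective _)) card_octonionAut_le
    rw [Subgroup.closure_le]
    rintro a (rfl | rfl)
    · exact hx
    · exact hy
  · rw [← hST]
    refine le_card_of_orbits S T (fun p => ?_) (fun q hq => ?_) fun r hr => ?_
    · exact exists_of_subset_orbitStep_iterate hx' hy' 0 10 _ h0 p (Finset.mem_univ p)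
    · obtain ⟨g, hg, rfl⟩ := exists_of_subset_orbitStep_iterate
        (x := wordValue x y v) (y := wordValue x y w)
        (Subgroup.mem_inf.2 ⟨hmem v, hstab0 _ hv⟩) (Subgroup.mem_inf.2 ⟨hmem w, hstab0 _ hw⟩)
        1 12 S h1 q hq
      exact ⟨g, (Subgroup.mem_inf.1 hg).1, (Subgroup.mem_inf.1 hg).2, rfl⟩
    · obtain ⟨g, hg, rfl⟩ := exists_of_subset_orbitStep_iterate
        (x := wordValue x y v') (y := wordValue x y w')
        (Subgroup.mem_inf.2 ⟨hmem v', hstab _ hv'⟩) (Subgroup.mem_inf.2 ⟨hmem w', hstab _ hw'⟩)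
        2 8 T h2 r hr
      obtain ⟨h0, h1⟩ := Subgroup.mem_inf.1 (Subgroup.mem_inf.1 hg).2
      exact ⟨g, (Subgroup.mem_inf.1 hg).1, h0, h1, rfl⟩

theorem card_monodromyGroup_mapTwoFaces_three :
    Nat.card (mapTwoFaces 3).monodromyGroup = 1344 := by
  rw [monodromyGroup_eq]
  exact card_eq_of_octonions (x := (mapTwoFaces 3).x) (y := (mapTwoFaces 3).y)
    (by constructor <;> decide +kernel) (by constructor <;> decide +kernel)
    -- Images of 1 avoid ±0, and images of 2 avoid ±0, ±1 and the product ±3: 12 and 8 choices.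
    (Finset.univ \ {0, 7}) {2, 4, 5, 6, 9, 11, 12, 13} (by decide +kernel)
    [0, 1, 0, 0] [1, 0, 1, 0, 1, 0, 1, 0, 0, 1, 0]
    [0, 0, 1, 0, 1, 0, 0, 1, 0, 1] [0, 1, 0, 1, 0, 0, 1, 0, 1, 0, 0, 1, 0, 0, 1, 0, 1, 0, 1, 0, 0]
    (by decide +kernel) (by decide +kernel) (by decide +kernel) (by decide +kernel)
    (by decide +kernel) (by decide +kernel) (by decide +kernel)

theorem card_monodromyGroup_mapTwoFaces_four :
    Nat.card (mapTwoFaces 4).monodromyGroup = 1344 := by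
  rw [monodromyGroup_eq]
  exact card_eq_of_octonions (x := (mapTwoFaces 4).x) (y := (mapTwoFaces 4).y)
    (by constructor <;> decide +kernel) (by constructor <;> decide +kernel)
    (Finset.univ \ {0, 7}) {2, 4, 5, 6, 9, 11, 12, 13} (by decide +kernel)
    [0, 0, 1, 0] [0, 1, 0, 1, 0, 1, 0, 0, 1, 0, 0]
    [0, 1, 0, 0, 1, 0, 1, 0, 0, 1] [0, 0, 1, 0, 1, 0, 1, 0, 0, 1, 0, 0, 1, 0, 1, 0, 0, 1, 0, 1, 0]
    (by decide +kernel) (by decide +kernel) (by decide +kernel) (by decide +kernel)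
    (by decide +kernel) (by decide +kernel) (by decide +kernel)

theorem card_monodromyGroup_mapTwoFaces_five :
    Nat.card (mapTwoFaces 5).monodromyGroup = 1344 := by
  rw [monodromyGroup_eq]
  exact card_eq_of_octonions (x := (mapTwoFaces 5).x) (y := (mapTwoFaces 5).y)
    (by constructor <;> decide +kernel) (by constructor <;> decide +kernel)
    (Finset.univ \ {0, 7}) {2, 4, 5, 6, 9, 11, 12, 13} (by decide +kernel)
    [1, 0, 1, 0, 0] [0, 0, 1, 0, 1, 0, 0, 1, 0]
    [1, 0, 1, 0, 1, 0, 0, 1, 0, 1, 0, 0, 1, 0, 0, 1, 0, 1, 0, 1, 0, 0]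
    [0, 1, 0, 1, 0, 1, 0, 0, 1, 0, 1, 0, 0, 1, 0, 1, 0, 1, 0, 0, 1, 0, 1, 0]
    (by decide +kernel) (by decide +kernel) (by decide +kernel) (by decide +kernel)
    (by decide +kernel) (by decide +kernel) (by decide +kernel)

theorem card_monodromyGroup_mapTwoFaces_six :
    Nat.card (mapTwoFaces 6).monodromyGroup = 1344 := by
  rw [monodromyGroup_eq]
  exact card_eq_of_octonions (x := (mapTwoFaces 6).x) (y := (mapTwoFaces 6).y)
    (by constructor <;> decide +kernel) (by constructor <;> decide +kernel)
    (Finset.univ \ {0, 7}) {2, 4, 5, 6, 9, 11, 12, 13} (by decide +kernel)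
    [1, 0, 0, 1, 0] [0, 1, 0, 0, 1, 0, 1, 0, 0]
    [1, 0, 0, 1, 0, 1, 0, 1, 0, 0, 1, 0, 0, 1, 0, 1, 0, 0, 1, 0, 1, 0]
    [0, 1, 0, 1, 0, 0, 1, 0, 0, 1, 0, 1, 0, 1, 0, 0, 1, 0, 1, 0, 0, 1, 0, 1]
    (by decide +kernel) (by decide +kernel) (by decide +kernel) (by decide +kernel)
    (by decide +kernel) (by decide +kernel) (by decide +kernel)

/-! ### The two trees -/

section Tree

theorem graph_adj (D : Dessin) (i : Fin D.degree) :
    D.graph.Adj (Sum.inl (D.blackEnd i)) (Sum.inr (D.whiteEnd i)) := by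
  rw [graph, SimpleGraph.fromRel_adj]
  exact ⟨by simp, Or.inl ⟨i, rfl, rfl⟩⟩

theorem blackEnd_x (D : Dessin) (i : Fin D.degree) : D.blackEnd (D.x i) = D.blackEnd i :=
  Quotient.sound ((Equiv.Perm.sameCycle_apply_left (f := D.x)).2 (Equiv.Perm.SameCycle.refl _ _))

theorem whiteEnd_y (D : Dessin) (i : Fin D.degree) : D.whiteEnd (D.y i) = D.whiteEnd i :=
  Quotient.sound ((Equiv.Perm.sameCycle_apply_left (f := D.y)).2 (Equiv.Perm.SameCycle.refl _ _))

theorem graph_connected (D : Dessin) : D.graph.Connected := by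
  let o : Fin D.degree := ⟨0, D.degree_pos⟩
  let S : Set (Fin D.degree) :=
    {i | D.graph.Reachable (Sum.inl (D.blackEnd o)) (Sum.inl (D.blackEnd i))}
  have hx : ∀ i ∈ S, D.x i ∈ S := fun i hi => by
    change D.graph.Reachable _ _
    rw [blackEnd_x]
    exact hi
  have hy : ∀ i ∈ S, D.y i ∈ S := fun i hi => by
    refine SimpleGraph.Reachable.trans hi ((D.graph_adj i).reachable.trans ?_)
    rw [← D.whiteEnd_y]
    exact (D.graph_adj _).symm.reachable
  have hz : ∀ i ∈ S, D.z i ∈ S := fun i hi => by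
    have : D.z i = D.x⁻¹ (D.y⁻¹ i) := by
      rw [← Equiv.Perm.mul_apply, ← mul_inv_rev, eq_inv_of_mul_eq_one_left
        ((mul_assoc D.z D.y D.x).symm.trans D.xyz_eq_one)]
    rw [this]
    exact Equiv.Perm.inv_mem_of_forall_mem _ hx (Equiv.Perm.inv_mem_of_forall_mem _ hy hi)
  have hS := D.forall_mem_of_invariant S hx hy hz (i := o) (SimpleGraph.Reachable.refl _)
  have hreach : ∀ u, D.graph.Reachable (Sum.inl (D.blackEnd o)) u := by
    rintro (u | u)
    · obtain ⟨i, rfl⟩ := Quotient.exists_rep u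
      exact hS i
    · obtain ⟨i, rfl⟩ := Quotient.exists_rep u
      exact (hS i).trans (D.graph_adj i).reachable
  have : Nonempty (D.BlackVertex ⊕ D.WhiteVertex) := ⟨Sum.inl (D.blackEnd o)⟩
  exact ⟨fun u v => (hreach u).symm.trans (hreach v)⟩

theorem card_edgeSet_le (D : Dessin) : Nat.card D.graph.edgeSet ≤ D.degree := by
  have hsub : D.graph.edgeSet ⊆
      Set.range fun i => s(Sum.inl (D.blackEnd i), Sum.inr (D.whiteEnd i)) := by
    intro e
    induction e using Sym2.ind with
    | _ u v =>
      rw [SimpleGraph.mem_edgeSet, graph, SimpleGraph.fromRel_adj]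
      rintro ⟨-, ⟨i, rfl, rfl⟩ | ⟨i, rfl, rfl⟩⟩
      · exact ⟨i, rfl⟩
      · exact ⟨i, Sym2.eq_swap⟩
  calc Nat.card D.graph.edgeSet ≤ Nat.card _ := Nat.card_mono (Set.toFinite _) hsub
    _ ≤ Nat.card (Fin D.degree) := Finite.card_range_le _
    _ = D.degree := by simp

/-- The graph is connected, so it has at least one edge fewer than vertices; it has at most `degree`
edges, so equality holds throughout. -/
theorem isTree_of_card (D : Dessin)
    (hinj : Function.Injective fun i => (D.blackEnd i, D.whiteEnd i))
    (hcard : D.degree + 1 = Nat.card D.BlackVertex + Nat.card D.WhiteVertex) : D.IsTree := by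
  refine ⟨hinj, SimpleGraph.isTree_iff_connected_and_card.2 ⟨D.graph_connected, ?_⟩⟩
  have h1 := D.graph_connected.card_vert_le_card_edgeSet_add_one
  have h2 := D.card_edgeSet_le
  rw [Nat.card_sum] at h1 ⊢
  omega

/-- An explicit labelling of the cycles makes their number and incidences decidable by evaluation.
-/
theorem sameCycle_iff_of_label {α β : Type*} [Finite α] {g : Equiv.Perm α} {f : α → β} (k : ℕ)
    (h1 : ∀ i, f (g i) = f i) (h2 : ∀ i j, f i = f j → ∃ l < k, g^[l] i = j) (i j : α) :
    g.SameCycle i j ↔ f i = f j := by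
  constructor
  · intro h
    obtain ⟨l, -, rfl⟩ := h.exists_pow_eq'
    clear h
    rw [← Equiv.Perm.iterate_eq_pow]
    induction l with
    | zero => rfl
    | succ l ih => rw [Function.iterate_succ_apply', h1, ← ih]
  · intro h
    obtain ⟨l, -, rfl⟩ := h2 i j h
    rw [Equiv.Perm.iterate_eq_pow]
    exact ⟨l, by simp⟩

theorem card_cycles_of_label {α : Type*} [Finite α] {g : Equiv.Perm α} {m : ℕ} {f : α → Fin m}
    (hf : Function.Surjective f) (h : ∀ i j, g.SameCycle i j ↔ f i = f j) :
    Nat.card (Quotient (Equiv.Perm.SameCycle.setoid g)) = m := by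
  have : Function.Bijective (Quotient.lift (s := Equiv.Perm.SameCycle.setoid g) f
      fun i j hij => (h i j).1 hij) := by
    constructor
    · intro u v
      induction u using Quotient.inductionOn
      induction v using Quotient.inductionOn
      exact fun huv => Quotient.sound ((h _ _).2 huv)
    · intro b
      obtain ⟨i, rfl⟩ := hf b
      exact ⟨Quotient.mk _ i, rfl⟩
  rw [Nat.card_eq_of_bijective _ this, Nat.card_fin]

theorem isTree_mapOneFace (i : Fin 4) (hi : (i : ℕ) < 2) : (mapOneFace i).IsTree := by
  -- Three black and five white vertices on seven edges: 3 + 5 = 7 + 1.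
  have main : ∀ (D : Dessin) (b : Fin D.degree → Fin 3) (w : Fin D.degree → Fin 5),
      D.degree = 7 → (∀ i, b (D.x i) = b i) → (∀ i j, b i = b j → ∃ l < 3, D.x^[l] i = j) →
      (∀ i, w (D.y i) = w i) → (∀ i j, w i = w j → ∃ l < 2, D.y^[l] i = j) →
      (∀ i, ∃ j, b j = i) → (∀ i, ∃ j, w j = i) →
      (∀ i j, b i = b j → w i = w j → i = j) → D.IsTree := by
    intro D b w hD hb1 hb2 hw1 hw2 hb hw hbw
    have hb' := sameCycle_iff_of_label 3 hb1 hb2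
    have hw' := sameCycle_iff_of_label 2 hw1 hw2
    refine D.isTree_of_card (fun i j hij => ?_) ?_
    · exact hbw i j ((hb' i j).1 (Quotient.exact (congrArg Prod.fst hij)))
        ((hw' i j).1 (Quotient.exact (congrArg Prod.snd hij)))
    · rw [hD, BlackVertex, WhiteVertex, card_cycles_of_label hb hb', card_cycles_of_label hw hw']
  match i, hi with
  | 0, _ =>
    exact main (mapOneFace 0) (fun i => (![0, 0, 1, 0, 1, 1, 2] : Fin 7 → Fin 3) ⟨i, i.2⟩)
      (fun i => (![0, 1, 2, 3, 4, 1, 2] : Fin 7 → Fin 5) ⟨i, i.2⟩)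
      rfl (by decide +kernel) (by decide +kernel) (by decide +kernel) (by decide +kernel)
      (by decide +kernel) (by decide +kernel) (by decide +kernel)
  | 1, _ =>
    exact main (mapOneFace 1) (fun i => (![0, 0, 1, 0, 1, 1, 2] : Fin 7 → Fin 3) ⟨i, i.2⟩)
      (fun i => (![0, 1, 2, 3, 4, 1, 2] : Fin 7 → Fin 5) ⟨i, i.2⟩)
      rfl (by decide +kernel) (by decide +kernel) (by decide +kernel) (by decide +kernel)
      (by decide +kernel) (by decide +kernel) (by decide +kernel)

end Tree

/-! ### Group orders that separate the cases, and degrees -/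

section Orders

/-- The translation t ↦ t + 1 has order 13, and all groups isomorphic to PSL₂(13) share this
divisor. -/
theorem thirteen_dvd_card {D : Dessin} (h : D.HasMonodromyPSL 2 (ZMod 13)) :
    13 ∣ Nat.card D.monodromyGroup := by
  obtain ⟨e⟩ := h
  obtain ⟨f⟩ := hasMonodromyPSL_mapTwoFaces_zero
  rw [Nat.card_congr (e.trans f.symm).toEquiv]
  let w : List ℕ := [1, 0, 1, 0, 0, 1, 0, 1, 0, 0, 1, 0, 0, 1, 0]
  let g : (mapTwoFaces 0).monodromyGroup := ⟨wordValue (mapTwoFaces 0).x (mapTwoFaces 0).y w,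
    wordValue_mem (x_mem_monodromyGroup _) (y_mem_monodromyGroup _) w⟩
  have hg : orderOf g = 13 := by
    rw [← Subgroup.orderOf_coe]
    have h13 : ∀ i, (wordValue (mapTwoFaces 0).x (mapTwoFaces 0).y w ^ 13) i = i := by
      decide +kernel
    have hne : ∃ i, wordValue (mapTwoFaces 0).x (mapTwoFaces 0).y w i ≠ i := by decide +kernel
    refine orderOf_eq_prime (Equiv.ext h13) fun h1 => ?_
    obtain ⟨i, hi⟩ := hne
    exact hi (DFunLike.congr_fun h1 i)
  rw [← hg]
  exact orderOf_dvd_natCard g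

/-- PSL₃(2) acts faithfully on seven points, so its order divides 7! = 5040; neither 13 nor 1344
divides 5040. -/
theorem card_dvd_of_hasMonodromyPSL_three {D : Dessin} (h : D.HasMonodromyPSL 3 (ZMod 2)) :
    Nat.card D.monodromyGroup ∣ 5040 := by
  obtain ⟨e⟩ := h
  obtain ⟨f⟩ := hasMonodromyPSL_mapOneFace_zero
  rw [Nat.card_congr (e.trans f.symm).toEquiv]
  have h1 := Subgroup.card_subgroup_dvd_card (mapOneFace 0).monodromyGroup
  have h2 : Nat.card (Equiv.Perm (Fin (mapOneFace 0).degree)) = 5040 := by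
    rw [Nat.card_perm, Nat.card_fin]
    rfl
  rwa [h2] at h1

end Orders

theorem degree_mapOneFace_le (i : Fin 4) : (mapOneFace i).degree ≤ 9 := by
  revert i
  decide +kernel

theorem degree_mapTwoFaces (i : Fin 12) :
    (mapTwoFaces i).degree = if (i : ℕ) < 9 then 14 else 15 := by
  revert i
  decide +kernel

theorem HasType.degree_lt_or_le {D : Dessin} (h : D.HasType 3 2 7) :
    D.degree < 16 ∨ 21 ≤ D.degree := by
  by_contra! hn
  have hk : D.IsMap327 (D.faceCount 7) := ⟨h, rfl⟩
  have hcard := card_support_of_isMap327 hk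
  have hle : D.z.support.card ≤ D.degree := D.z.support.card_le_univ.trans (by simp)
  have hpos : 0 < D.z.support.card := by
    obtain ⟨i, hi⟩ := h.exists_z_ne
    exact Finset.card_pos.2 ⟨i, Equiv.Perm.mem_support.2 hi⟩
  -- Here 0 < 7k ≤ 20, so the classification applies.
  obtain h1 | h2 : D.faceCount 7 = 1 ∨ D.faceCount 7 = 2 := by omega
  · rw [h1] at hk
    obtain ⟨i, e⟩ := exists_isIso_mapOneFace hk
    have h9 := degree_mapOneFace_le i
    rw [invariant_degree _ _ _ e rfl] at h9
    omega
  · rw [h2] at hk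
    obtain ⟨i, e⟩ := exists_isIso_mapTwoFaces hk
    have h15 := degree_mapTwoFaces i
    rw [invariant_degree _ _ _ e rfl] at h15
    split_ifs at h15 <;> omega

end Dessin

/-! ### Hurwitz groups -/

section Hurwitz

/-- If one generator is trivial, the other two are inverse to each other; their orders divide
coprime numbers, so all three are trivial, against nontriviality of the group. -/
theorem exists_generators_of_isHurwitzGroup {G : Type*} [Group G] (h : IsHurwitzGroup G) :
    ∃ X Y Z : G, X ^ 2 = 1 ∧ Y ^ 3 = 1 ∧ Z ^ 7 = 1 ∧ X * Y * Z = 1 ∧ X ≠ 1 ∧ Y ≠ 1 ∧ Z ≠ 1 ∧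
      Subgroup.closure {X, Y, Z} = ⊤ := by
  obtain ⟨-, hG, f, hf⟩ := h
  let g : Fin 3 → G := fun i => f (PresentedGroup.of i)
  have hrel := fun (w : FreeGroup (Fin 3)) hw =>
    (congrArg f (PresentedGroup.one_of_mem (x := w) hw)).trans (map_one f)
  have hX : g 0 ^ 2 = 1 := by
    have := hrel (FreeGroup.of 0 ^ 2) (by simp)
    rwa [map_pow, map_pow] at this
  have hY : g 1 ^ 3 = 1 := by
    have := hrel (FreeGroup.of 1 ^ 3) (by simp)
    rwa [map_pow, map_pow] at this
  have hZ : g 2 ^ 7 = 1 := by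
    have := hrel (FreeGroup.of 2 ^ 7) (by simp)
    rwa [map_pow, map_pow] at this
  have hXYZ : g 0 * g 1 * g 2 = 1 := by
    have := hrel (FreeGroup.of 0 * FreeGroup.of 1 * FreeGroup.of 2) (by simp)
    rwa [map_mul, map_mul, map_mul, map_mul] at this
  have hcl : Subgroup.closure {g 0, g 1, g 2} = ⊤ := by
    have h1 := PresentedGroup.closure_range_of ({FreeGroup.of 0 ^ 2, FreeGroup.of 1 ^ 3,
      FreeGroup.of 2 ^ 7, FreeGroup.of 0 * FreeGroup.of 1 * FreeGroup.of 2} :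
      Set (FreeGroup (Fin 3)))
    have h2 := congrArg (Subgroup.map f) h1
    rw [MonoidHom.map_closure, ← MonoidHom.range_eq_map, MonoidHom.range_eq_top.2 hf,
      ← Set.range_comp] at h2
    rw [← h2]
    congr 1
    ext a
    constructor
    · rintro (rfl | rfl | rfl)
      · exact ⟨0, rfl⟩
      · exact ⟨1, rfl⟩
      · exact ⟨2, rfl⟩
    · rintro ⟨i, rfl⟩
      fin_cases i
      · exact Or.inl rfl
      · exact Or.inr (Or.inl rfl)
      · exact Or.inr (Or.inr rfl)
  have hcop : ∀ (a : G) (m n : ℕ), m.Coprime n → a ^ m = 1 → a ^ n = 1 → a = 1 := by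
    intro a m n hmn hm hn
    simpa [hmn.gcd_eq_one] using pow_gcd_eq_one.2 ⟨hm, hn⟩
  have hall : ¬ (g 0 = 1 ∧ g 1 = 1 ∧ g 2 = 1) := by
    rintro ⟨h0, h1, h2⟩
    rw [h0, h1, h2] at hcl
    have : (⊤ : Subgroup G) = ⊥ := by
      rw [← hcl, Subgroup.closure_eq_bot_iff]
      simp
    exact absurd this (bot_ne_top).symm
  refine ⟨g 0, g 1, g 2, hX, hY, hZ, hXYZ, fun h => ?_, fun h => ?_, fun h => ?_, hcl⟩
  · rw [h, one_mul] at hXYZ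
    have h2 : g 2 = 1 := hcop _ 3 7 (by norm_num)
      (by rw [eq_inv_of_mul_eq_one_right hXYZ, inv_pow, hY, inv_one]) hZ
    exact hall ⟨h, by rwa [h2, mul_one] at hXYZ, h2⟩
  · rw [h, mul_one] at hXYZ
    have h2 : g 2 = 1 := hcop _ 2 7 (by norm_num)
      (by rw [eq_inv_of_mul_eq_one_right hXYZ, inv_pow, hX, inv_one]) hZ
    exact hall ⟨by rwa [h2, mul_one] at hXYZ, h, h2⟩
  · rw [h, mul_one] at hXYZ
    have h2 : g 1 = 1 := hcop _ 2 3 (by norm_num)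
      (by rw [eq_inv_of_mul_eq_one_right hXYZ, inv_pow, hX, inv_one]) hY
    exact hall ⟨by rwa [h2, mul_one] at hXYZ, h2, h⟩

/-- The action on the cosets is transitive, and faithful because its kernel is the core, so the
generators keep their orders. -/
theorem exists_dessin_of_isHurwitzGroup {G : Type*} [Group G] {n : ℕ} (hn : 0 < n)
    (h : IsHurwitzGroup G) (hq : HasFaithfulQuotient G n) :
    ∃ D : Dessin, D.degree = n ∧ D.HasType 3 2 7 := by
  obtain ⟨X, Y, Z, hX, hY, hZ, hXYZ, hX1, hY1, hZ1, hcl⟩ := exists_generators_of_isHurwitzGroup h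
  obtain ⟨H, hH, hcore⟩ := hq
  have hcard : Nat.card (G ⧸ H) = n := hH
  have hfin : Finite (G ⧸ H) := Nat.finite_of_card_ne_zero (by omega)
  let e : G ⧸ H ≃ Fin n := (Finite.equivFin (G ⧸ H)).trans (finCongr hcard)
  let ρ : G →* Equiv.Perm (Fin n) :=
    (e.permCongrHom : _ →* Equiv.Perm (Fin n)).comp (MulAction.toPermHom G (G ⧸ H))
  have hρ : Function.Injective ρ := by
    refine e.permCongrHom.injective.comp ?_
    rw [← MonoidHom.ker_eq_bot_iff, ← Subgroup.normalCore_eq_ker, hcore]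
  have hρe : ∀ (g : G) (a : G ⧸ H), ρ g (e a) = e (g • a) := by
    intro g a
    change e (g • e.symm (e a)) = _
    rw [Equiv.symm_apply_apply]
  have hne : ∀ {g : G}, g ≠ 1 → ρ g ≠ 1 := fun hg h1 => hg (hρ (h1.trans (map_one ρ).symm))
  have hrange : Subgroup.closure {ρ Y, ρ X, ρ Z} = ρ.range := by
    rw [MonoidHom.range_eq_map, ← hcl, MonoidHom.map_closure, Set.image_insert_eq, Set.image_pair,
      Set.insert_comm]
  let D : Dessin :=
    { degree := n
      degree_pos := hn
      -- The generators of orders 2 and 3 change places; the relation becomes ZXY = 1, a conjugate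
      -- of XYZ = 1.
      x := ρ Y
      y := ρ X
      z := ρ Z
      xyz_eq_one := by
        rw [← map_mul, ← map_mul, mul_assoc, eq_inv_of_mul_eq_one_left hXYZ, mul_inv_cancel,
          map_one]
      transitive := by
        rw [hrange]
        constructor
        intro i j
        obtain ⟨a, rfl⟩ := e.surjective i
        obtain ⟨b, rfl⟩ := e.surjective j
        obtain ⟨g, rfl⟩ := MulAction.exists_smul_eq G a b
        exact ⟨⟨ρ g, g, rfl⟩, hρe g a⟩ }
  have : Fact (Nat.Prime 7) := ⟨by norm_num⟩
  exact ⟨D, rfl, orderOf_eq_prime (by rw [← map_pow, hY, map_one]) (hne hY1),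
    orderOf_eq_prime (by rw [← map_pow, hX, map_one]) (hne hX1),
    orderOf_eq_prime (by rw [← map_pow, hZ, map_one]) (hne hZ1)⟩

theorem not_isHurwitzGroup_of_hasFaithfulQuotient {G : Type*} [Group G] {n : ℕ} (h1 : 16 ≤ n)
    (h2 : n ≤ 20) (hq : HasFaithfulQuotient G n) : ¬ IsHurwitzGroup G := by
  intro h
  obtain ⟨D, hD, ht⟩ := exists_dessin_of_isHurwitzGroup (by omega) h hq
  rcases ht.degree_lt_or_le with h | h <;> omega

theorem hasFaithfulQuotient_alternatingGroup {n : ℕ} (hn : 3 ≤ n) :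
    HasFaithfulQuotient (alternatingGroup (Fin n)) n := by
  have htrans : MulAction.IsPretransitive (alternatingGroup (Fin n)) (Fin n) :=
    alternatingGroup.isPretransitive_of_three_le_card (Fin n) (by simpa using hn)
  let o : Fin n := ⟨0, by omega⟩
  refine ⟨MulAction.stabilizer (alternatingGroup (Fin n)) o, ?_, ?_⟩
  · rw [MulAction.index_stabilizer_of_transitive, Nat.card_fin]
  · rw [eq_bot_iff]
    intro g hg
    rw [Subgroup.mem_bot]
    refine Subtype.ext (Equiv.ext fun i => ?_)
    obtain ⟨k, rfl⟩ := MulAction.exists_smul_eq (alternatingGroup (Fin n)) o i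
    -- An element of the core has all its conjugates in the stabiliser of `o`, so it fixes every
    -- point of the orbit of `o`.
    have h1 : (k⁻¹ * g * k⁻¹⁻¹) • o = o := hg k⁻¹
    rw [inv_inv, mul_smul, mul_smul, inv_smul_eq_iff] at h1
    exact h1

end Hurwitz

/-! ### The classification in terms of the indices of the maps -/

namespace Dessin

theorem hasMonodromyPSL_mapTwoFaces_thirteen (i : Fin 12) (hi : (i : ℕ) < 3) :
    (mapTwoFaces i).HasMonodromyPSL 2 (ZMod 13) := by
  match i, hi with
  | 0, _ => exact hasMonodromyPSL_mapTwoFaces_zero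
  | 1, _ => exact hasMonodromyPSL_mapTwoFaces_one
  | 2, _ => exact hasMonodromyPSL_mapTwoFaces_two

theorem card_monodromyGroup_mapTwoFaces (i : Fin 12) (hi : 3 ≤ (i : ℕ) ∧ (i : ℕ) < 7) :
    Nat.card (mapTwoFaces i).monodromyGroup = 1344 := by
  match i, hi with
  | 3, _ => exact card_monodromyGroup_mapTwoFaces_three
  | 4, _ => exact card_monodromyGroup_mapTwoFaces_four
  | 5, _ => exact card_monodromyGroup_mapTwoFaces_five
  | 6, _ => exact card_monodromyGroup_mapTwoFaces_six

theorem hasMonodromyPSL_mapTwoFaces_of_seven_le (i : Fin 12) (hi : 7 ≤ (i : ℕ) ∧ (i : ℕ) < 9) :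
    (mapTwoFaces i).HasMonodromyPSL 3 (ZMod 2) := by
  match i, hi with
  | 7, _ => exact hasMonodromyPSL_mapTwoFaces_seven
  | 8, _ => exact hasMonodromyPSL_mapTwoFaces_eight

theorem nonempty_monodromyGroup_mapTwoFaces_equiv (i : Fin 12) (hi : 9 ≤ (i : ℕ)) :
    Nonempty ((mapTwoFaces i).monodromyGroup ≃* alternatingGroup (Fin 15)) := by
  match i, hi with
  | 9, _ => exact nonempty_monodromyGroup_mapTwoFaces_nine_equiv
  | 10, _ => exact nonempty_monodromyGroup_mapTwoFaces_ten_equiv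
  | 11, _ => exact nonempty_monodromyGroup_mapTwoFaces_eleven_equiv

theorem isImprimitive_mapTwoFaces_iff (i : Fin 12) (hi : (i : ℕ) < 9) :
    (mapTwoFaces i).IsImprimitive ↔ 3 ≤ (i : ℕ) :=
  ⟨fun h => by
    by_contra! h3
    exact not_isImprimitive_mapTwoFaces i h3 h, fun h => isImprimitive_mapTwoFaces i h hi⟩

theorem hasMonodromyPSL_mapTwoFaces_thirteen_iff (i : Fin 12) (hi : (i : ℕ) < 9) :
    (mapTwoFaces i).HasMonodromyPSL 2 (ZMod 13) ↔ (i : ℕ) < 3 := by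
  refine ⟨fun h => ?_, hasMonodromyPSL_mapTwoFaces_thirteen i⟩
  by_contra! h3
  have h13 := thirteen_dvd_card h
  by_cases h7 : (i : ℕ) < 7
  · rw [card_monodromyGroup_mapTwoFaces i ⟨h3, h7⟩] at h13
    norm_num at h13
  · have := h13.trans (card_dvd_of_hasMonodromyPSL_three
      (hasMonodromyPSL_mapTwoFaces_of_seven_le i ⟨by omega, hi⟩))
    norm_num at this

theorem not_hasMonodromyPSL_of_card_eq {D : Dessin} (h : Nat.card D.monodromyGroup = 1344) :
    ¬ D.HasMonodromyPSL 3 (ZMod 2) := by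
  intro h'
  have := card_dvd_of_hasMonodromyPSL_three h'
  rw [h] at this
  norm_num at this

theorem numberUpToIso_mapTwoFaces {Q : Dessin → Prop} (hQ : Invariant Q) (p : ℕ → Prop)
    [DecidablePred p] (h : ∀ i : Fin 12, Q (mapTwoFaces i) ↔ p i) :
    numberUpToIso (fun D => D.IsMap327 2 ∧ Q D) =
      (Finset.univ.filter fun i : Fin 12 => p i).card :=
  numberUpToIso_eq_card mapTwoFaces eq_of_isIso_mapTwoFaces isMap327_mapTwoFaces
    (fun _ => exists_isIso_mapTwoFaces) hQ _ (by simpa using h)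

theorem numberUpToIso_mapOneFace {Q : Dessin → Prop} (hQ : Invariant Q) (p : ℕ → Prop)
    [DecidablePred p] (h : ∀ i : Fin 4, Q (mapOneFace i) ↔ p i) :
    numberUpToIso (fun D => D.IsMap327 1 ∧ Q D) =
      (Finset.univ.filter fun i : Fin 4 => p i).card :=
  numberUpToIso_eq_card mapOneFace eq_of_isIso_mapOneFace isMap327_mapOneFace
    (fun _ => exists_isIso_mapOneFace) hQ _ (by simpa using h)

theorem invariant_true : Invariant fun _ => True := fun _ _ _ h => h

theorem degree_mapOneFace (i : Fin 4) :
    (mapOneFace i).degree = if (i : ℕ) < 2 then 7 else if (i : ℕ) < 3 then 8 else 9 := by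
  revert i
  decide +kernel

theorem hasMonodromyPSL_mapOneFace_seven (i : Fin 4) (hi : (i : ℕ) < 2) :
    (mapOneFace i).HasMonodromyPSL 3 (ZMod 2) := by
  match i, hi with
  | 0, _ => exact hasMonodromyPSL_mapOneFace_zero
  | 1, _ => exact hasMonodromyPSL_mapOneFace_one

theorem hasMonodromyPSL_mapOneFace_eight (i : Fin 4) (hi : (i : ℕ) = 2) :
    (mapOneFace i).HasMonodromyPSL 2 (ZMod 7) := by
  obtain rfl : i = 2 := Fin.ext hi
  exact hasMonodromyPSL_mapOneFace_two

theorem hasMonodromyPSL_mapOneFace_nine (i : Fin 4) (hi : (i : ℕ) = 3) :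
    (mapOneFace i).HasMonodromyPSL 2 (GaloisField 2 3) := by
  obtain rfl : i = 3 := Fin.ext hi
  exact hasMonodromyPSL_mapOneFace_three

end Dessin

open Dessin in
theorem mainTheorem4 :
    -- the maps with two faces of degree 7: twelve, namely 3 + (4 + 2) + 3
    Dessin.numberUpToIso (Dessin.IsMap327 2) = 12 ∧
    Dessin.numberUpToIso (fun D => D.IsMap327 2 ∧ D.degree = 14 ∧
      D.HasMonodromyPSL 2 (ZMod 13)) = 3 ∧
    Dessin.numberUpToIso (fun D => D.IsMap327 2 ∧ D.degree = 14 ∧ D.IsImprimitive) = 6 ∧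
    Dessin.numberUpToIso (fun D => D.IsMap327 2 ∧ D.degree = 14 ∧ D.IsImprimitive ∧
      Nat.card D.monodromyGroup = 1344) = 4 ∧
    Dessin.numberUpToIso (fun D => D.IsMap327 2 ∧ D.degree = 14 ∧ D.IsImprimitive ∧
      D.HasMonodromyPSL 3 (ZMod 2)) = 2 ∧
    Dessin.numberUpToIso (fun D => D.IsMap327 2 ∧ D.degree = 15 ∧
      Nonempty (D.monodromyGroup ≃* alternatingGroup (Fin 15))) = 3 ∧
    (∀ D : Dessin, D.IsMap327 2 →
      (D.degree = 14 ∧ D.HasMonodromyPSL 2 (ZMod 13)) ∨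
      (D.degree = 14 ∧ D.IsImprimitive ∧
        (Nat.card D.monodromyGroup = 1344 ∨ D.HasMonodromyPSL 3 (ZMod 2))) ∨
      (D.degree = 15 ∧ Nonempty (D.monodromyGroup ≃* alternatingGroup (Fin 15)))) ∧
    -- the maps with one face of degree 7: four, namely 2 + 1 + 1
    Dessin.numberUpToIso (Dessin.IsMap327 1) = 4 ∧
    Dessin.numberUpToIso (fun D => D.IsMap327 1 ∧ D.degree = 7 ∧ D.IsTree ∧
      D.HasMonodromyPSL 3 (ZMod 2)) = 2 ∧
    Dessin.numberUpToIso (fun D => D.IsMap327 1 ∧ D.degree = 8 ∧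
      D.HasMonodromyPSL 2 (ZMod 7)) = 1 ∧
    Dessin.numberUpToIso (fun D => D.IsMap327 1 ∧ D.degree = 9 ∧
      D.HasMonodromyPSL 2 (GaloisField 2 3)) = 1 ∧
    (∀ D : Dessin, D.IsMap327 1 →
      (D.degree = 7 ∧ D.IsTree ∧ D.HasMonodromyPSL 3 (ZMod 2)) ∨
      (D.degree = 8 ∧ D.HasMonodromyPSL 2 (ZMod 7)) ∨
      (D.degree = 9 ∧ D.HasMonodromyPSL 2 (GaloisField 2 3))) ∧
    -- the consequence for Hurwitz groups
    (∀ (G : Type*) [Group G] (n : ℕ), 16 ≤ n → n ≤ 20 → HasFaithfulQuotient G n →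
      ¬ IsHurwitzGroup G) ∧
    (∀ n : ℕ, 16 ≤ n → n ≤ 20 → ¬ IsHurwitzGroup (alternatingGroup (Fin n))) := by
  have inv14 := invariant_degree 14
  have invPSL := fun (n : ℕ) (K : Type) (_ : CommRing K) => invariant_hasMonodromyPSL n K
  have deg14 : ∀ i : Fin 12, (mapTwoFaces i).degree = 14 ↔ (i : ℕ) < 9 := fun i => by
    rw [degree_mapTwoFaces]
    split_ifs <;> omega
  have deg15 : ∀ i : Fin 12, (mapTwoFaces i).degree = 15 ↔ 9 ≤ (i : ℕ) := fun i => by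
    rw [degree_mapTwoFaces]
    split_ifs <;> omega
  have deg7 : ∀ i : Fin 4, (mapOneFace i).degree = 7 ↔ (i : ℕ) < 2 := fun i => by
    rw [degree_mapOneFace]
    split_ifs <;> omega
  have deg8 : ∀ i : Fin 4, (mapOneFace i).degree = 8 ↔ (i : ℕ) = 2 := fun i => by
    rw [degree_mapOneFace]
    split_ifs <;> omega
  have deg9 : ∀ i : Fin 4, (mapOneFace i).degree = 9 ↔ (i : ℕ) = 3 := fun i => by
    rw [degree_mapOneFace]
    split_ifs <;> omega
  refine ⟨?_, ?_, ?_, ?_, ?_, ?_, ?_, ?_, ?_, ?_, ?_, ?_, ?_, ?_⟩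
  · have := numberUpToIso_mapTwoFaces invariant_true (fun _ => True) fun _ => Iff.rfl
    simpa using this
  · refine (numberUpToIso_mapTwoFaces (inv14.and (invPSL 2 (ZMod 13) _)) (· < 3)
      fun i => ?_).trans rfl
    rw [deg14]
    exact ⟨fun h => (hasMonodromyPSL_mapTwoFaces_thirteen_iff i h.1).1 h.2,
      fun h => ⟨by omega, hasMonodromyPSL_mapTwoFaces_thirteen i h⟩⟩
  · refine (numberUpToIso_mapTwoFaces (inv14.and invariant_isImprimitive)
      (fun i => 3 ≤ i ∧ i < 9) fun i => ?_).trans rfl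
    rw [deg14]
    exact ⟨fun h => ⟨(isImprimitive_mapTwoFaces_iff i h.1).1 h.2, h.1⟩,
      fun h => ⟨h.2, isImprimitive_mapTwoFaces i h.1 h.2⟩⟩
  · refine (numberUpToIso_mapTwoFaces (inv14.and (invariant_isImprimitive.and
      (invariant_card 1344))) (fun i => 3 ≤ i ∧ i < 7) fun i => ?_).trans rfl
    rw [deg14]
    refine ⟨fun ⟨h9, him, hc⟩ => ⟨(isImprimitive_mapTwoFaces_iff i h9).1 him, ?_⟩,
      fun h => ⟨by omega, isImprimitive_mapTwoFaces i h.1 (by omega),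
        card_monodromyGroup_mapTwoFaces i h⟩⟩
    by_contra! h7
    exact not_hasMonodromyPSL_of_card_eq hc (hasMonodromyPSL_mapTwoFaces_of_seven_le i ⟨h7, h9⟩)
  · refine (numberUpToIso_mapTwoFaces (inv14.and (invariant_isImprimitive.and
      (invPSL 3 (ZMod 2) _))) (fun i => 7 ≤ i ∧ i < 9) fun i => ?_).trans rfl
    rw [deg14]
    refine ⟨fun ⟨h9, him, hc⟩ => ⟨?_, h9⟩, fun h =>
      ⟨h.2, isImprimitive_mapTwoFaces i (by omega) h.2, hasMonodromyPSL_mapTwoFaces_of_seven_le i h⟩⟩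
    by_contra! h7
    exact not_hasMonodromyPSL_of_card_eq (card_monodromyGroup_mapTwoFaces i
      ⟨(isImprimitive_mapTwoFaces_iff i h9).1 him, h7⟩) hc
  · refine (numberUpToIso_mapTwoFaces ((invariant_degree 15).and
      (invariant_monodromyGroup_equiv (alternatingGroup (Fin 15)))) (9 ≤ ·) fun i => ?_).trans rfl
    rw [deg15]
    exact ⟨fun h => h.1, fun h => ⟨h, nonempty_monodromyGroup_mapTwoFaces_equiv i h⟩⟩
  · intro D hD
    obtain ⟨i, e⟩ := exists_isIso_mapTwoFaces hD
    -- The whole alternative is invariant, so it need only be checked on the representative.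
    refine (((inv14.and (invPSL 2 (ZMod 13) _)).or ((inv14.and (invariant_isImprimitive.and
      ((invariant_card 1344).or (invPSL 3 (ZMod 2) _)))).or ((invariant_degree 15).and
      (invariant_monodromyGroup_equiv (alternatingGroup (Fin 15)))))).iff e).2 ?_
    rcases lt_or_ge (i : ℕ) 3 with h3 | h3
    · exact Or.inl ⟨(deg14 i).2 (by omega), hasMonodromyPSL_mapTwoFaces_thirteen i h3⟩
    rcases lt_or_ge (i : ℕ) 9 with h9 | h9
    · refine Or.inr (Or.inl ⟨(deg14 i).2 h9, isImprimitive_mapTwoFaces i h3 h9, ?_⟩)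
      rcases lt_or_ge (i : ℕ) 7 with h7 | h7
      · exact Or.inl (card_monodromyGroup_mapTwoFaces i ⟨h3, h7⟩)
      · exact Or.inr (hasMonodromyPSL_mapTwoFaces_of_seven_le i ⟨h7, h9⟩)
    · exact Or.inr (Or.inr ⟨(deg15 i).2 h9, nonempty_monodromyGroup_mapTwoFaces_equiv i h9⟩)
  · have := numberUpToIso_mapOneFace invariant_true (fun _ => True) fun _ => Iff.rfl
    simpa using this
  · refine (numberUpToIso_mapOneFace ((invariant_degree 7).and (invariant_isTree.and
      (invPSL 3 (ZMod 2) _))) (· < 2) fun i => ?_).trans rfl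
    rw [deg7]
    exact ⟨fun h => h.1, fun h => ⟨h, isTree_mapOneFace i h, hasMonodromyPSL_mapOneFace_seven i h⟩⟩
  · refine (numberUpToIso_mapOneFace ((invariant_degree 8).and (invPSL 2 (ZMod 7) _)) (· = 2)
      fun i => ?_).trans rfl
    rw [deg8]
    exact ⟨fun h => h.1, fun h => ⟨h, hasMonodromyPSL_mapOneFace_eight i h⟩⟩
  · refine (numberUpToIso_mapOneFace ((invariant_degree 9).and (invPSL 2 (GaloisField 2 3) _))
      (· = 3) fun i => ?_).trans rfl
    rw [deg9]
    exact ⟨fun h => h.1, fun h => ⟨h, hasMonodromyPSL_mapOneFace_nine i h⟩⟩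
  · intro D hD
    obtain ⟨i, e⟩ := exists_isIso_mapOneFace hD
    refine ((((invariant_degree 7).and (invariant_isTree.and (invPSL 3 (ZMod 2) _))).or
      (((invariant_degree 8).and (invPSL 2 (ZMod 7) _)).or
      ((invariant_degree 9).and (invPSL 2 (GaloisField 2 3) _)))).iff e).2 ?_
    rcases lt_or_ge (i : ℕ) 2 with h2 | h2
    · exact Or.inl ⟨(deg7 i).2 h2, isTree_mapOneFace i h2, hasMonodromyPSL_mapOneFace_seven i h2⟩
    obtain h2 | h3 : (i : ℕ) = 2 ∨ (i : ℕ) = 3 := by omega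
    · exact Or.inr (Or.inl ⟨(deg8 i).2 h2, hasMonodromyPSL_mapOneFace_eight i h2⟩)
    · exact Or.inr (Or.inr ⟨(deg9 i).2 h3, hasMonodromyPSL_mapOneFace_nine i h3⟩)
  · exact fun G _ n h1 h2 hq => not_isHurwitzGroup_of_hasFaithfulQuotient h1 h2 hq
  · exact fun n h1 h2 => not_isHurwitzGroup_of_hasFaithfulQuotient h1 h2
      (hasFaithfulQuotient_alternatingGroup (by omega))
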